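/- All matroids are finite. For a matroid $M$ on $E$ with $|E|=n$ and rank function $r$, and an ordering $\pi=(e_1,\dots,e_n)$ of $E$, the rank sequence of $\pi$ is $\underline r(\pi)=r_1r_2\cdots r_n$ with $r_i=r(\{e_1,\dots,e_i\})-r(\{e_1,\dots,e_{i-1}\})$. The $\mathcal G$-invariant of $M$ is the formal linear combination $\mathcal G(M)=\sum_\pi[\underline r(\pi)]$, over all orderings $\pi$ of $E$, of formal symbols $[\underline r]$ indexed by sequences, with coefficients in a fixed field of characteristic zero. A cyclic flat of $M$ is a flat $F$ such that the restriction $M|F$ has no coloops; $\mathcal Z(M)$ denotes the set of cyclic flats, which is a lattice under inclusion. Two matroids $M$ and $N$ have the same configuration if there is a lattice isomorphism $\phi:\mathcal Z(M)\to\mathcal Z(N)$ with $|\phi(Z)|=|Z|$ and $r_N(\phi(Z))=r_M(Z)$ for all $Z\in\mathcal Z(M)$; otherwise their configurations are different. Let $M$ be a loopless matroid on $E$ with rank function $r$, and let $m\ge 1$. For each $e\in E$ let $T_e$ be a set of size $m$, where the sets $T_e$ are pairwise disjoint and disjoint from $E$, and let $a\notin E\cup\bigcup_{e\in E}T_e$.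 For $S\subseteq E$ let $q(S)=S\cup\{a\}\cup\bigcup_{e\in S}T_e$. The free $m$-cone $Q_m(M)$ is the unique matroid on $q(E)$ whose cyclic flats are exactly the cyclic flats $Z$ of $M$, with rank $r(Z)$, and the sets $q(F)$ where $F$ is a nonempty flat of $M$, with rank $r(F)+1$. **Theorem.** Let $M$ and $N$ be nonisomorphic loopless matroids with $\mathcal G(M)=\mathcal G(N)$. Then for every $m\ge 1$, the free $m$-cones $Q_m(M)$ and $Q_m(N)$ have the same $\mathcal G$-invariant and different configurations. -/

import Mathlib

open Set

namespace Matroid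

/-! ### Isomorphism, the G-invariant and the configuration -/

/-- Two matroids are isomorphic if there is a bijection between their ground sets that preserves
independence in both directions. -/
def IsIsomorphic {α β : Type*} (M : Matroid α) (N : Matroid β) : Prop :=
  ∃ e : M.E ≃ N.E, ∀ I : Set M.E,
    M.Indep ((fun x : M.E => (x : α)) '' I) ↔ N.Indep ((fun x : M.E => (e x : β)) '' I)

/-- The rank of a set as a natural number (the matroids of interest are finite). -/
noncomputable def natRk {α : Type*} (M : Matroid α) (X : Set α) : ℕ := (M.eRk X).toNat

/-- The rank sequence `r₁ r₂ ⋯ rₙ` of an ordering `π` of the ground set, where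
`rᵢ = r({π(1), …, π(i)}) - r({π(1), …, π(i-1)})`. (The rank is monotone, so that the
subtraction of natural numbers is the usual one.) -/
noncomputable def rankSequence {α : Type*} (M : Matroid α) {n : ℕ} (π : Fin n ≃ M.E) : List ℕ :=
  List.ofFn fun i : Fin n =>
    M.natRk ((fun j => (π j : α)) '' Set.Iic i) - M.natRk ((fun j => (π j : α)) '' Set.Iio i)

/-- The G-invariant of a finite matroid: the formal sum, with coefficients in a field `K`, of the
rank sequences of all orderings of the ground set. The formal symbols `[r]` are the basis vectors
`Finsupp.single r 1`; the sum is over a finite type. -/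
noncomputable def gInvariant (K : Type*) [Field K] {α : Type*} (M : Matroid α) [M.Finite] :
    List ℕ →₀ K :=
  ∑ᶠ π : Fin M.E.ncard ≃ M.E, Finsupp.single (M.rankSequence π) (1 : K)

/-- The set of cyclic flats of `M`: the flats `F` such that `M|F` has no coloops. -/
def cyclicFlats {α : Type*} (M : Matroid α) : Set (Set α) :=
  {F | M.IsFlat F ∧ (M ↾ F).coloops = ∅}

/-- `M` and `N` have the same configuration: there is an isomorphism between their lattices of
cyclic flats (ordered by inclusion) that preserves the size and the rank. An isomorphism of
lattices is the same as an isomorphism of the underlying orders. -/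
def SameConfiguration {α β : Type*} (M : Matroid α) (N : Matroid β) : Prop :=
  ∃ φ : M.cyclicFlats ≃o N.cyclicFlats, ∀ Z : M.cyclicFlats,
    (φ Z : Set β).encard = (Z : Set α).encard ∧ N.eRk (φ Z : Set β) = M.eRk (Z : Set α)

/-! ### The free `m`-cone -/

/-- The possible elements of a free `m`-cone over a matroid with elements in `α`: a copy of each
`e : α`, the `m` elements of the set `T_e` for each `e : α`, and the tip. -/
inductive ConePoint (α : Type*) (m : ℕ) : Type _
  | base (e : α) : ConePoint α m
  | fiber (e : α) (i : Fin m) : ConePoint α m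
  | tip : ConePoint α m

/-- The cone `q(S) = S ∪ {a} ∪ ⋃_{e ∈ S} T_e` of a set `S`. -/
def cone {α : Type*} (m : ℕ) (S : Set α) : Set (ConePoint α m) :=
  ConePoint.base '' S ∪ {ConePoint.tip} ∪ ⋃ e ∈ S, Set.range (ConePoint.fiber e)

/-- `Q` is the free `m`-cone of `M`: its ground set is `E ∪ T ∪ {a}`, its cyclic flats are the
cyclic flats of `M` and the cones of the nonempty flats of `M`, a cyclic flat of `M` has the same
rank in `Q` as in `M`, and the cone of a nonempty flat `F` of `M` has rank `r(F) + 1`. -/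
structure IsFreeCone {α : Type*} (m : ℕ) (M : Matroid α) (Q : Matroid (ConePoint α m)) :
    Prop where
  ground_eq : Q.E = cone m M.E
  cyclicFlats_eq : Q.cyclicFlats =
    (fun Z : Set α => ConePoint.base '' Z) '' M.cyclicFlats ∪
      cone m '' {F | M.IsFlat F ∧ F.Nonempty}
  eRk_base : ∀ Z ∈ M.cyclicFlats, Q.eRk (ConePoint.base '' Z) = M.eRk Z
  eRk_cone : ∀ F, M.IsFlat F → F.Nonempty → Q.eRk (cone m F) = M.eRk F + 1

/-! ### Existence and uniqueness of the free `m`-cone -/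

section Existence

variable {α : Type*} {m : ℕ}

@[simp] lemma base_mem_cone {S : Set α} {e : α} :
    ConePoint.base e ∈ cone m S ↔ e ∈ S := by
  simp [cone]

@[simp] lemma fiber_mem_cone {S : Set α} {e : α} {i : Fin m} :
    ConePoint.fiber e i ∈ cone m S ↔ e ∈ S := by
  simp [cone]

@[simp] lemma tip_mem_cone {S : Set α} : (ConePoint.tip : ConePoint α m) ∈ cone m S := by
  simp [cone]

lemma cone_finite {S : Set α} (hS : S.Finite) : (cone m S).Finite :=
  ((hS.image _).union (finite_singleton _)).union (hS.biUnion fun _ _ => finite_range _)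

lemma base_injective : Function.Injective (ConePoint.base : α → ConePoint α m) := by
  intro x y h
  cases h
  rfl

lemma mem_cyclicFlats_iff {M : Matroid α} {F : Set α} :
    F ∈ M.cyclicFlats ↔ M.IsFlat F ∧ ∀ x ∈ F, x ∈ M.closure (F \ {x}) := by
  refine and_congr_right fun hF => ?_
  rw [eq_empty_iff_forall_notMem]
  refine forall_congr' fun x => ?_
  rw [← isColoop_iff_mem_coloops, restrict_isColoop_iff hF.subset_ground]
  tauto

/-- A set is independent if and only if it meets each cyclic flat in at most rank many elements. -/
lemma indep_iff_cyclicFlats (M : Matroid α) [M.Finite] {I : Set α} (hI : I ⊆ M.E) :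
    M.Indep I ↔ ∀ Z ∈ M.cyclicFlats, (I ∩ Z).encard ≤ M.eRk Z := by
  refine ⟨fun h Z _ => (h.subset inter_subset_left).encard_le_eRk_of_subset inter_subset_right,
    fun h => ?_⟩
  by_contra hcon
  obtain ⟨C, hCI, hC⟩ := ((not_indep_iff hI).1 hcon).exists_isCircuit_subset
  have hCcl : C ⊆ M.closure C := M.subset_closure C hC.subset_ground
  have hZ : M.closure C ∈ M.cyclicFlats := by
    refine mem_cyclicFlats_iff.2 ⟨isFlat_closure _, fun x hx => ?_⟩
    by_cases hxC : x ∈ C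
    · exact M.closure_subset_closure (sdiff_subset_sdiff_left hCcl)
        (hC.mem_closure_sdiff_singleton_of_mem hxC)
    · exact M.closure_subset_closure (subset_sdiff_singleton hCcl hxC) hx
  have h1 := h _ hZ
  rw [eRk_closure_eq] at h1
  have h2 := hC.dep.eRk_lt_encard
  exact absurd (h2.trans_le ((encard_le_encard (subset_inter hCI hCcl)).trans h1)) (lt_irrefl _)

lemma IsFreeCone.unique {M : Matroid α} [M.Finite] {Q Q' : Matroid (ConePoint α m)}
    (h : IsFreeCone m M Q) (h' : IsFreeCone m M Q') : Q = Q' := by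
  have : Q.Finite := ⟨h.ground_eq ▸ cone_finite M.ground_finite⟩
  have : Q'.Finite := ⟨h'.ground_eq ▸ cone_finite M.ground_finite⟩
  have hE : Q.E = Q'.E := h.ground_eq.trans h'.ground_eq.symm
  refine ext_indep hE fun I hI => ?_
  rw [indep_iff_cyclicFlats Q hI, indep_iff_cyclicFlats Q' (hE ▸ hI),
    h.cyclicFlats_eq, h'.cyclicFlats_eq]
  refine forall₂_congr fun Z hZ => ?_
  rcases hZ with ⟨Z, hZ, rfl⟩ | ⟨F, hF, rfl⟩
  · simp only [h.eRk_base Z hZ, h'.eRk_base Z hZ]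
  · rw [h.eRk_cone F hF.1 hF.2, h'.eRk_cone F hF.1 hF.2]

/-- The map that sends an element `e` and all elements of `T_e` to `e`; the tip goes to `none`. -/
def coneProj : ConePoint α m → Option α
  | .base e => some e
  | .fiber e _ => some e
  | .tip => none

/-- The matroid obtained from `M` by adding each element of `T_e` parallel to `e`. -/
def coneShadow (m : ℕ) (M : Matroid α) : Matroid (ConePoint α m) :=
  (M.map some (Option.some_injective α).injOn).comap coneProj

lemma coneShadow_indep_iff {M : Matroid α} {I : Set (ConePoint α m)} :
    (coneShadow m M).Indep I ↔
      (∃ J, M.Indep J ∧ coneProj '' I = some '' J) ∧ InjOn coneProj I := Iff.rfl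

lemma coneShadow_subset {M : Matroid α} {I : Set (ConePoint α m)}
    (h : (coneShadow m M).Indep I) : I ⊆ cone m M.E := by
  obtain ⟨⟨J, hJ, hIJ⟩, -⟩ := coneShadow_indep_iff.1 h
  intro x hx
  have hx' : coneProj x ∈ some '' J := hIJ ▸ mem_image_of_mem _ hx
  obtain ⟨e, he, hex⟩ := hx'
  have heE := hJ.subset_ground he
  cases x <;> simp_all [coneProj]

lemma coneShadow_tip {M : Matroid α} {I : Set (ConePoint α m)}
    (h : (coneShadow m M).Indep I) : ConePoint.tip ∉ I := by
  obtain ⟨⟨J, hJ, hIJ⟩, -⟩ := coneShadow_indep_iff.1 h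
  intro hx
  have hx' : coneProj (ConePoint.tip : ConePoint α m) ∈ some '' J := hIJ ▸ mem_image_of_mem _ hx
  simp [coneProj] at hx'

lemma coneProj_image_base (J : Set α) :
    coneProj '' ((ConePoint.base : α → ConePoint α m) '' J) = some '' J := by
  rw [image_image]
  rfl

lemma coneShadow_base {M : Matroid α} {J : Set α} :
    (coneShadow m M).Indep (ConePoint.base '' J) ↔ M.Indep J := by
  rw [coneShadow_indep_iff, coneProj_image_base]
  constructor
  · rintro ⟨⟨J', hJ', h⟩, -⟩
    rwa [(Option.some_injective α).image_injective h]
  · refine fun h => ⟨⟨J, h, rfl⟩, ?_⟩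
    rintro _ ⟨x, _, rfl⟩ _ ⟨y, _, rfl⟩ hxy
    simpa [coneProj] using hxy

lemma coneShadow_insert {M : Matroid α} {J : Set α} {x : ConePoint α m} {e : α}
    (hx : coneProj x = some e) (hxJ : x ∉ ConePoint.base '' J) :
    (coneShadow m M).Indep (insert x (ConePoint.base '' J)) ↔ M.Indep (insert e J) ∧ e ∉ J := by
  rw [coneShadow_indep_iff, image_insert_eq, coneProj_image_base, hx, ← image_insert_eq,
    injOn_insert hxJ, coneProj_image_base, hx]
  constructor
  · rintro ⟨⟨J', hJ', h⟩, -, h2⟩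
    rw [(Option.some_injective α).image_injective h]
    exact ⟨hJ', fun he => h2 (mem_image_of_mem _ he)⟩
  · rintro ⟨h, he⟩
    refine ⟨⟨_, h, rfl⟩, ?_, by simpa using he⟩
    rintro _ ⟨x, _, rfl⟩ _ ⟨y, _, rfl⟩ hxy
    simpa [coneProj] using hxy

lemma augment_ncard {N : Matroid α} {I J : Set α} (hI : N.Indep I) (hJ : N.Indep J)
    (hIf : I.Finite) (hJf : J.Finite) (h : I.ncard < J.ncard) :
    ∃ e ∈ J \ I, N.Indep (insert e I) := by
  refine hI.augment hJ ?_
  rw [← hIf.cast_ncard_eq, ← hJf.cast_ncard_eq]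
  exact_mod_cast h

/-- An explicit construction of the free cone: a set is independent if removing a suitable element
outside the base makes it independent in `coneShadow`. -/
def coneMatroid (m : ℕ) (M : Matroid α) (hM : M.E.Finite) : Matroid (ConePoint α m) :=
  (IndepMatroid.ofFinite (E := cone m M.E) (cone_finite hM)
    (fun I => I ⊆ cone m M.E ∧ ∃ y, y ∉ range ConePoint.base ∧ (coneShadow m M).Indep (I \ {y}))
    ⟨empty_subset _, ConePoint.tip, by simp, by simp⟩
    (fun I J ⟨h, y, hy, hJ⟩ hIJ =>
      ⟨hIJ.trans h, y, hy, hJ.subset (sdiff_subset_sdiff_left hIJ)⟩)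
    (by
      rintro I J ⟨hIE, x, hx, hI⟩ ⟨hJE, y, hy, hJ⟩ hlt
      have hIf : I.Finite := (cone_finite hM).subset hIE
      have hJf : J.Finite := (cone_finite hM).subset hJE
      have key : (coneShadow m M).Indep I → ∃ e ∈ J, e ∉ I ∧ insert e I ⊆ cone m M.E ∧
          ∃ y, y ∉ range ConePoint.base ∧ (coneShadow m M).Indep (insert e I \ {y}) := by
        intro hI
        by_cases hc : I.ncard < (J \ {y}).ncard
        · obtain ⟨e, he, h⟩ := augment_ncard hI hJ hIf (hJf.subset sdiff_subset) hc
          exact ⟨e, he.1.1, he.2, insert_subset (hJE he.1.1) hIE, y, hy, h.subset sdiff_subset⟩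
        have hyJ : y ∈ J := by
          by_contra hyJ
          rw [sdiff_singleton_eq_self hyJ] at hc
          exact hc hlt
        by_cases hyI : y ∈ I
        · have h1 : (I \ {y}).ncard < (J \ {y}).ncard := by
            rw [ncard_sdiff_singleton_of_mem hyI, ncard_sdiff_singleton_of_mem hyJ]
            have := (ncard_pos hIf).2 ⟨y, hyI⟩
            omega
          obtain ⟨e, he, h⟩ := augment_ncard (hI.subset sdiff_subset) hJ
            (hIf.subset sdiff_subset) (hJf.subset sdiff_subset) h1
          refine ⟨e, he.1.1, fun heI => he.2 ⟨heI, he.1.2⟩, insert_subset (hJE he.1.1) hIE, y, hy,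
            h.subset ?_⟩
          rintro z ⟨rfl | hz, hzy⟩
          · exact mem_insert _ _
          · exact mem_insert_of_mem _ ⟨hz, hzy⟩
        · refine ⟨y, hyJ, hyI, insert_subset (hJE hyJ) hIE, y, hy, hI.subset ?_⟩
          rintro z ⟨rfl | hz, hzy⟩
          · exact absurd rfl hzy
          · exact hz
      by_cases hc : (I \ {x}).ncard < (J \ {y}).ncard
      · obtain ⟨e, he, h⟩ := augment_ncard hI hJ (hIf.subset sdiff_subset)
          (hJf.subset sdiff_subset) hc
        by_cases heI : e ∈ I
        · have hex : e = x := by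
            by_contra hne
            exact he.2 ⟨heI, hne⟩
          subst hex
          refine key (h.subset ?_)
          intro z hz
          by_cases hze : z = e
          · exact Or.inl hze
          · exact Or.inr ⟨hz, hze⟩
        · refine ⟨e, he.1.1, heI, insert_subset (hJE he.1.1) hIE, x, hx, h.subset ?_⟩
          rintro z ⟨rfl | hz, hzy⟩
          · exact mem_insert _ _
          · exact mem_insert_of_mem _ ⟨hz, hzy⟩
      · have hxI : x ∉ I := by
          intro hxI
          rw [ncard_sdiff_singleton_of_mem hxI] at hc
          have h1 := (ncard_pos hIf).2 ⟨x, hxI⟩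
          have h2 := pred_ncard_le_ncard_sdiff_singleton J y
          omega
        rw [sdiff_singleton_eq_self hxI] at hI
        exact key hI)
    (fun _ h => h.1)).matroid

variable {M : Matroid α} {hM : M.E.Finite}

lemma coneMatroid_ground : (coneMatroid m M hM).E = cone m M.E := rfl

lemma coneMatroid_indep_iff {I : Set (ConePoint α m)} : (coneMatroid m M hM).Indep I ↔
    I ⊆ cone m M.E ∧ ∃ y, y ∉ range ConePoint.base ∧ (coneShadow m M).Indep (I \ {y}) := Iff.rfl

lemma coneMatroid_indep_insert {I : Set (ConePoint α m)} {y : ConePoint α m}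
    (hI : (coneShadow m M).Indep I) (hy : y ∈ cone m M.E) (hyb : y ∉ range ConePoint.base) :
    (coneMatroid m M hM).Indep (insert y I) := by
  refine coneMatroid_indep_iff.2 ⟨insert_subset hy (coneShadow_subset hI), y, hyb, hI.subset ?_⟩
  rintro z ⟨rfl | hz, hzy⟩
  · exact absurd rfl hzy
  · exact hz

lemma coneMatroid_base {J : Set α} :
    (coneMatroid m M hM).Indep (ConePoint.base '' J) ↔ M.Indep J := by
  rw [coneMatroid_indep_iff, ← coneShadow_base (m := m)]
  constructor
  · rintro ⟨_, y, hy, h⟩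
    rwa [sdiff_singleton_eq_self fun h' => hy (image_subset_range _ _ h')] at h
  · exact fun h => ⟨coneShadow_subset h, ConePoint.tip, by simp, h.subset sdiff_subset⟩

lemma coneMatroid_tip {I : Set (ConePoint α m)} (htip : ConePoint.tip ∉ I) :
    (coneMatroid m M hM).Indep (insert ConePoint.tip I) ↔ (coneShadow m M).Indep I := by
  refine ⟨fun h => ?_, fun h => coneMatroid_indep_insert h (by simp) (by simp)⟩
  obtain ⟨_, y, hy, h⟩ := coneMatroid_indep_iff.1 h
  have hyt : y = ConePoint.tip := by
    by_contra hne
    exact coneShadow_tip h ⟨mem_insert _ _, fun h => hne h.symm⟩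
  subst hyt
  refine h.subset fun z hz => ⟨Or.inr hz, ?_⟩
  rintro rfl
  exact htip hz

lemma coneMatroid_isBasis {B X : Set α} (hB : M.IsBasis B X) :
    (coneMatroid m M hM).IsBasis (ConePoint.base '' B) (ConePoint.base '' X) := by
  refine (coneMatroid_base.2 hB.indep).isBasis_of_forall_insert (image_mono hB.subset) ?_
  rintro _ ⟨⟨e, he, rfl⟩, heB⟩
  have heB' : e ∉ B := fun h => heB (mem_image_of_mem _ h)
  have hsub : ConePoint.base '' insert e B ⊆ (coneMatroid m M hM).E := by
    rintro _ ⟨f, hf, rfl⟩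
    rw [coneMatroid_ground, base_mem_cone]
    exact insert_subset (hB.subset_ground he) hB.indep.subset_ground hf
  rw [← image_insert_eq, ← not_indep_iff hsub, coneMatroid_base]
  exact (hB.insert_dep ⟨he, heB'⟩).not_indep

lemma coneMatroid_closure_base {X : Set α} (hX : X ⊆ M.E) :
    (coneMatroid m M hM).closure (ConePoint.base '' X) = ConePoint.base '' M.closure X := by
  obtain ⟨B, hB⟩ := M.exists_isBasis X hX
  rw [← (coneMatroid_isBasis hB).closure_eq_closure, ← hB.closure_eq_closure]
  ext x
  rw [(coneMatroid_base.2 hB.indep).mem_closure_iff', coneMatroid_ground]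
  by_cases hx : x ∈ range (ConePoint.base : α → ConePoint α m)
  · obtain ⟨e, rfl⟩ := hx
    rw [← image_insert_eq, coneMatroid_base, base_injective.mem_set_image,
      base_injective.mem_set_image, base_mem_cone, hB.indep.mem_closure_iff']
  · constructor
    · rintro ⟨hxE, h⟩
      exact absurd (image_subset_range _ _
        (h (coneMatroid_indep_insert (coneShadow_base.2 hB.indep) hxE hx))) hx
    · exact fun h => absurd (image_subset_range _ _ h) hx

lemma coneMatroid_isFlat_base {F : Set α} (hF : F ⊆ M.E) :
    (coneMatroid m M hM).IsFlat (ConePoint.base '' F) ↔ M.IsFlat F := by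
  rw [isFlat_iff_closure_eq, isFlat_iff_closure_eq, coneMatroid_closure_base hF,
    base_injective.image_injective.eq_iff]

lemma coneMatroid_cyclic_base {F : Set α} (hF : F ⊆ M.E) :
    ConePoint.base '' F ∈ (coneMatroid m M hM).cyclicFlats ↔ F ∈ M.cyclicFlats := by
  rw [mem_cyclicFlats_iff, mem_cyclicFlats_iff, coneMatroid_isFlat_base hF, forall_mem_image]
  refine and_congr_right fun _ => forall₂_congr fun x _ => ?_
  rw [← image_singleton, ← image_sdiff base_injective,
    coneMatroid_closure_base (sdiff_subset.trans hF), base_injective.mem_set_image]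

lemma coneMatroid_isBasis_cone {B F : Set α} (hB : M.IsBasis B F) :
    (coneMatroid m M hM).IsBasis (insert ConePoint.tip (ConePoint.base '' B)) (cone m F) := by
  have ht : (ConePoint.tip : ConePoint α m) ∉ ConePoint.base '' B := by simp
  refine ((coneMatroid_tip ht).2 (coneShadow_base.2 hB.indep)).isBasis_of_forall_insert
    (insert_subset (by simp) ?_) ?_
  · rintro _ ⟨e, he, rfl⟩
    simpa using hB.subset he
  rintro x ⟨hxF, hx⟩
  rw [mem_insert_iff, not_or] at hx
  have hxE : x ∈ cone m M.E := by
    have := hB.subset_ground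
    cases x
    · simp only [base_mem_cone] at hxF ⊢; exact this hxF
    · simp only [fiber_mem_cone] at hxF ⊢; exact this hxF
    · simp
  rw [← not_indep_iff (insert_subset hxE ((coneMatroid_tip ht).2
    (coneShadow_base.2 hB.indep)).subset_ground), insert_comm, coneMatroid_tip]
  · obtain ⟨e, heF, hxe⟩ : ∃ e ∈ F, coneProj x = some e := by
      cases x with
      | base e => exact ⟨e, by simpa using hxF, rfl⟩
      | fiber e i => exact ⟨e, by simpa using hxF, rfl⟩
      | tip => exact absurd rfl hx.1
    rw [coneShadow_insert hxe hx.2]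
    rintro ⟨h1, h2⟩
    exact (hB.insert_dep ⟨heF, h2⟩).not_indep h1
  · rintro (h | h)
    · exact hx.1 h.symm
    · exact ht h

lemma coneMatroid_isFlat_cone {F : Set α} (hF : M.IsFlat F) :
    (coneMatroid m M hM).IsFlat (cone m F) := by
  obtain ⟨B, hB⟩ := M.exists_isBasis F hF.subset_ground
  have hQ := coneMatroid_isBasis_cone (m := m) (hM := hM) hB
  rw [isFlat_iff_closure_eq]
  refine subset_antisymm ?_ (subset_closure _ _ hQ.subset_ground)
  rw [← hQ.closure_eq_closure]
  intro x hx
  rw [hQ.indep.mem_closure_iff'] at hx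
  by_contra hxF
  have hxt : x ≠ ConePoint.tip := by
    rintro rfl
    simp at hxF
  have hxB : x ∉ ConePoint.base '' B := by
    rintro ⟨e, he, rfl⟩
    exact hxF (by simpa using hB.subset he)
  obtain ⟨e, heE, heF, hxe⟩ : ∃ e ∈ M.E, e ∉ F ∧ coneProj x = some e := by
    have h1 := hx.1
    rw [coneMatroid_ground] at h1
    cases x with
    | base e => exact ⟨e, by simpa using h1, by simpa using hxF, rfl⟩
    | fiber e i => exact ⟨e, by simpa using h1, by simpa using hxF, rfl⟩
    | tip => exact absurd rfl hxt
  have heB : e ∉ B := fun h => heF (hB.subset h)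
  have h2 : M.Indep (insert e B) := by
    rw [hB.indep.insert_indep_iff_of_notMem heB, hB.closure_eq_closure, hF.closure]
    exact ⟨heE, heF⟩
  have h3 : (coneMatroid m M hM).Indep (insert x (insert ConePoint.tip (ConePoint.base '' B))) := by
    rw [insert_comm, coneMatroid_tip]
    · exact (coneShadow_insert hxe hxB).2 ⟨h2, heB⟩
    · rintro (h | h)
      · exact hxt h.symm
      · simp at h
  rcases hx.2 h3 with h | h
  · exact hxt h
  · exact hxB h

lemma coneMatroid_triple [M.Loopless] {e : α} (he : e ∈ M.E) (i : Fin m)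
    {F : Set (ConePoint α m)} {x y z : ConePoint α m} (hyF : y ∈ F) (hzF : z ∈ F)
    (hxy : x ≠ y) (hxz : x ≠ z) (hyz : y ≠ z)
    (h : ({x, y, z} : Set (ConePoint α m)) =
      {ConePoint.base e, ConePoint.fiber e i, ConePoint.tip}) :
    x ∈ (coneMatroid m M hM).closure (F \ {x}) := by
  have hsub : ({x, y, z} : Set (ConePoint α m)) ⊆ (coneMatroid m M hM).E := by
    rw [h, coneMatroid_ground]
    rintro w (rfl | rfl | rfl) <;> simp [he]
  have hdep : (coneMatroid m M hM).Dep {x, y, z} := by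
    rw [← not_indep_iff hsub, h, insert_comm, show ({ConePoint.fiber e i, ConePoint.base e,
      ConePoint.tip} : Set (ConePoint α m)) = insert ConePoint.tip (insert (ConePoint.fiber e i)
        (ConePoint.base '' {e})) by ext; simp; tauto, coneMatroid_tip (by simp),
      coneShadow_insert (e := e) rfl (by simp)]
    simp
  have hne : M.Indep {e} := by
    rw [indep_singleton]
    exact isNonloop_of_loopless he
  have hb : (coneShadow m M).Indep {ConePoint.base e} := by
    rw [← image_singleton]
    exact coneShadow_base.2 hne
  have hf : (coneShadow m M).Indep {ConePoint.fiber e i} := by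
    have := (coneShadow_insert (m := m) (M := M) (J := ∅) (x := ConePoint.fiber e i) (e := e)
      rfl (by simp)).2 ⟨by simpa using hne, by simp⟩
    simpa using this
  have hyz' : (coneMatroid m M hM).Indep {y, z} := by
    have hy : y ∈ ({ConePoint.base e, ConePoint.fiber e i, ConePoint.tip} :
      Set (ConePoint α m)) := h ▸ by simp
    have hz : z ∈ ({ConePoint.base e, ConePoint.fiber e i, ConePoint.tip} :
      Set (ConePoint α m)) := h ▸ by simp
    have h1 : (coneMatroid m M hM).Indep {ConePoint.fiber e i, ConePoint.base e} :=
      coneMatroid_indep_insert hb (by simpa using he) (by simp)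
    have h2 : (coneMatroid m M hM).Indep {ConePoint.tip, ConePoint.base e} :=
      coneMatroid_indep_insert hb (by simp) (by simp)
    have h3 : (coneMatroid m M hM).Indep {ConePoint.tip, ConePoint.fiber e i} :=
      coneMatroid_indep_insert hf (by simp) (by simp)
    rcases hy with rfl | rfl | rfl <;> rcases hz with rfl | rfl | rfl
    · exact absurd rfl hyz
    · rwa [pair_comm]
    · rwa [pair_comm]
    · exact h1
    · exact absurd rfl hyz
    · rwa [pair_comm]
    · exact h2
    · exact h3
    · exact absurd rfl hyz
  refine (coneMatroid m M hM).closure_subset_closure (X := {y, z}) ?_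
    (hyz'.mem_closure_iff.2 (Or.inl hdep))
  rintro w (rfl | rfl)
  · exact ⟨hyF, hxy.symm⟩
  · exact ⟨hzF, hxz.symm⟩

theorem isFreeCone_coneMatroid (hm : 1 ≤ m) (M : Matroid α) [M.Finite] [M.Loopless] :
    IsFreeCone m M (coneMatroid m M M.ground_finite) := by
  refine ⟨coneMatroid_ground, ?_, ?_, ?_⟩
  · ext Z
    constructor
    · intro hZ
      obtain ⟨hfl, hcyc⟩ := mem_cyclicFlats_iff.1 hZ
      have hZE : Z ⊆ cone m M.E := hfl.subset_ground
      by_cases ht : ConePoint.tip ∈ Z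
      · right
        have hFE : ConePoint.base ⁻¹' Z ⊆ M.E := fun e he => by simpa using hZE he
        have hbase : ∀ e i, ConePoint.fiber e i ∈ Z → ConePoint.base e ∈ Z := by
          intro e i hf
          have heE : e ∈ M.E := by simpa using hZE hf
          have := coneMatroid_triple (hM := M.ground_finite) heE i (x := ConePoint.base e)
            hf ht (by simp) (by simp) (by simp) rfl
          rw [← hfl.closure]
          exact closure_subset_closure _ sdiff_subset this
        have hfib : ∀ e i, ConePoint.base e ∈ Z → ConePoint.fiber e i ∈ Z := by
          intro e i hf
          have heE : e ∈ M.E := by simpa using hZE hf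
          have := coneMatroid_triple (hM := M.ground_finite) heE i (x := ConePoint.fiber e i)
            hf ht (by simp) (by simp) (by simp) (insert_comm _ _ _)
          rw [← hfl.closure]
          exact closure_subset_closure _ sdiff_subset this
        have hZeq : cone m (ConePoint.base ⁻¹' Z) = Z := by
          ext x
          cases x with
          | base e => simp
          | fiber e i => simpa using ⟨hfib e i, hbase e i⟩
          | tip => simpa using ht
        refine ⟨ConePoint.base ⁻¹' Z, ⟨?_, ?_⟩, hZeq⟩
        · rw [← coneMatroid_isFlat_base (m := m) (hM := M.ground_finite) hFE]
          have hE := (coneMatroid_isFlat_base (m := m) (hM := M.ground_finite)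
            subset_rfl).2 M.ground_isFlat
          have h1 : (coneMatroid m M M.ground_finite).IsFlat (Z ∩ ConePoint.base '' M.E) := by
            rw [isFlat_iff_closure_eq]
            refine subset_antisymm (subset_inter ?_ ?_)
              (subset_closure _ _ (inter_subset_left.trans hfl.subset_ground))
            · exact (closure_subset_closure _ inter_subset_left).trans hfl.closure.subset
            · exact (closure_subset_closure _ inter_subset_right).trans hE.closure.subset
          convert h1 using 1
          ext x
          constructor
          · rintro ⟨e, he, rfl⟩
            exact ⟨he, mem_image_of_mem _ (hFE he)⟩
          · rintro ⟨hx, e, he, rfl⟩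
            exact ⟨e, hx, rfl⟩
        · by_contra hemp
          rw [not_nonempty_iff_eq_empty] at hemp
          have hZ0 : Z = {ConePoint.tip} := by
            rw [← hZeq, hemp]
            simp [cone]
          have h1 := hcyc _ ht
          have h2 : Z \ {ConePoint.tip} = ConePoint.base '' (∅ : Set α) := by simp [hZ0]
          rw [h2, coneMatroid_closure_base (empty_subset _)] at h1
          simp at h1
      · left
        have hZb : Z ⊆ range ConePoint.base := by
          intro x hxZ
          by_contra hxb
          have hx := hcyc x hxZ
          obtain ⟨I, hI⟩ := (coneMatroid m M M.ground_finite).exists_isBasis (Z \ {x})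
            (sdiff_subset.trans hfl.subset_ground)
          have htI : ConePoint.tip ∉ I := fun h => ht (hI.subset h).1
          have htcl : ConePoint.tip ∉ (coneMatroid m M M.ground_finite).closure I := by
            intro h
            apply ht
            rw [← hfl.closure]
            exact closure_subset_closure _ (hI.subset.trans sdiff_subset) h
          have h1 := (hI.indep.notMem_closure_iff_of_notMem htI
            (by rw [coneMatroid_ground]; simp)).1 htcl
          rw [coneMatroid_tip htI] at h1
          have h2 : (coneMatroid m M M.ground_finite).Indep (insert x I) :=
            coneMatroid_indep_insert h1 (hZE hxZ) hxb
          rw [← hI.closure_eq_closure] at hx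
          exact (hI.subset ((hI.indep.mem_closure_iff'.1 hx).2 h2)).2 rfl
        obtain ⟨F, rfl⟩ := subset_range_iff_exists_image_eq.1 hZb
        refine ⟨F, (coneMatroid_cyclic_base (m := m) ?_).1 hZ, rfl⟩
        intro e he
        simpa using hZE (mem_image_of_mem _ he)
    · rintro (⟨F, hF, rfl⟩ | ⟨F, ⟨hF, hne⟩, rfl⟩)
      · exact (coneMatroid_cyclic_base (mem_cyclicFlats_iff.1 hF).1.subset_ground).2 hF
      · refine mem_cyclicFlats_iff.2 ⟨coneMatroid_isFlat_cone hF, fun x hx => ?_⟩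
        have hFE := hF.subset_ground
        cases x with
        | base e =>
          have he : e ∈ F := by simpa using hx
          exact coneMatroid_triple (hFE he) ⟨0, hm⟩ (y := ConePoint.fiber e ⟨0, hm⟩)
            (z := ConePoint.tip) (by simpa using he) (by simp) (by simp) (by simp) (by simp) rfl
        | fiber e i =>
          have he : e ∈ F := by simpa using hx
          exact coneMatroid_triple (hFE he) i (y := ConePoint.base e)
            (z := ConePoint.tip) (by simpa using he) (by simp) (by simp) (by simp) (by simp)
            (insert_comm _ _ _)
        | tip =>
          obtain ⟨e, he⟩ := hne
          refine coneMatroid_triple (hFE he) ⟨0, hm⟩ (y := ConePoint.base e)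
            (z := ConePoint.fiber e ⟨0, hm⟩) (by simpa using he) (by simpa using he)
            (by simp) (by simp) (by simp) ?_
          ext
          simp
          tauto
  · intro Z hZ
    obtain ⟨B, hB⟩ := M.exists_isBasis Z (mem_cyclicFlats_iff.1 hZ).1.subset_ground
    rw [(coneMatroid_isBasis hB).eRk_eq_encard, hB.eRk_eq_encard, base_injective.encard_image]
  · intro F hF _
    obtain ⟨B, hB⟩ := M.exists_isBasis F hF.subset_ground
    rw [(coneMatroid_isBasis_cone hB).eRk_eq_encard, hB.eRk_eq_encard,
      encard_insert_of_notMem (by simp), base_injective.encard_image]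

/-- For `m ≥ 1`, every finite loopless matroid has exactly one free `m`-cone. -/
theorem existsUnique_isFreeCone (hm : 1 ≤ m) (M : Matroid α) [M.Finite] [M.Loopless] :
    ∃! Q : Matroid (ConePoint α m), IsFreeCone m M Q :=
  ⟨_, isFreeCone_coneMatroid hm M, fun _ h => h.unique (isFreeCone_coneMatroid hm M)⟩

end Existence

/-- The free `m`-cone `Q_m(M)` of a finite loopless matroid `M`, where `m ≥ 1`: the matroid on
`E ∪ T ∪ {a}` with the prescribed cyclic flats and ranks. -/
noncomputable def freeCone {α : Type*} (m : ℕ) (hm : 1 ≤ m) (M : Matroid α) [M.Finite]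
    [M.Loopless] : Matroid (ConePoint α m) :=
  (existsUnique_isFreeCone hm M).choose

theorem isFreeCone_freeCone {α : Type*} (m : ℕ) (hm : 1 ≤ m) (M : Matroid α) [M.Finite]
    [M.Loopless] : IsFreeCone m M (freeCone m hm M) :=
  (existsUnique_isFreeCone hm M).choose_spec.1

theorem freeCone_eq_coneMatroid {α : Type*} (m : ℕ) (hm : 1 ≤ m) (M : Matroid α) [M.Finite]
    [M.Loopless] : freeCone m hm M = coneMatroid m M M.ground_finite :=
  (isFreeCone_freeCone m hm M).unique (isFreeCone_coneMatroid hm M)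

instance freeCone_finite {α : Type*} (m : ℕ) (hm : 1 ≤ m) (M : Matroid α) [M.Finite]
    [M.Loopless] : (freeCone m hm M).Finite :=
  ⟨(isFreeCone_freeCone m hm M).ground_eq ▸ cone_finite M.ground_finite⟩

end Matroid

/-!
The two halves of the theorem are independent of each other.

*The G-invariant of the free cone is determined by that of the base.* For a set `X` of points of the
cone let `D` be the set of elements over which `X` has a point, `B` the part of `X` in the base, and
`f` the number of the other points of `X`. Then `r(X) = min (r(D) + 1) (r(B) + f)`, where the ranks
on the right are those of `M` (`eRk_coneMatroid`). An ordering of the cone amounts to an ordering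
`π` of `M.E` together with an ordering `w` of labels, each one occurring for every `π`, so it
suffices to fix `w` and let `π` vary. Along the initial segments of `w`, the equality
`r(D) = r(B) + f` holds up to some index `t` and fails from then on, so the rank sequence depends
only on `t` and on the ranks of the sets `D`. The number of `π` for which these ranks are prescribed
and equality holds at index `s` involves only ranks along the chain
`B 0 ⊆ ⋯ ⊆ B s ⊆ D s ⊆ D (s + 1) ⊆ ⋯` (`exists_equiv_orderRk_min`). After a permutation of the
positions this is a chain of initial segments, whose ranks have a distribution that is read off from
the G-invariant (`exists_equiv_orderRk_chain`).

*The configuration of the free cone determines the matroid.* Let `φ` be an isomorphism between the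
lattices of cyclic flats of the two cones that preserves size and rank. If `φ` matches the cones of
points (rank-one flats) with each other, then it matches the points along with their sizes, and the
rank of a set is one less than that of the join of the cones of its points
(`isIsomorphic_of_forall_pointCone`). A cyclic flat of rank two that is not the cone of a point is a
line in the base. That `φ` matches such a line with the cone of a point is excluded by comparing
joins and sizes, unless both matroids have rank two and no coloops
(`forall_pointCone_or_natRk_ground_eq_two`). In that case the base may indeed be exchanged with
the cone of a point, but the sizes of the points still agree, and in rank two these determine the
matroid (`isIsomorphic_of_natRk_ground_eq_two`).
-/

namespace Matroid

/-! ### The rank function of the free cone -/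

section ConeRank

variable {α : Type*} {m : ℕ}

/-- The elements `e` of `α` such that `X` contains the copy of `e` or an element of `T_e`. -/
def coneShade (X : Set (ConePoint α m)) : Set α :=
  {e | ConePoint.base e ∈ X ∨ ∃ i, ConePoint.fiber e i ∈ X}

lemma mem_coneShade_iff {X : Set (ConePoint α m)} {e : α} :
    e ∈ coneShade X ↔ ∃ x ∈ X, coneProj x = some e := by
  constructor
  · rintro (h | ⟨i, h⟩)
    · exact ⟨_, h, rfl⟩
    · exact ⟨_, h, rfl⟩
  · rintro ⟨x, hx, h⟩
    cases x with
    | base f => cases h; exact Or.inl hx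
    | fiber f i => cases h; exact Or.inr ⟨i, hx⟩
    | tip => cases h

variable {M : Matroid α} {hM : M.E.Finite}

lemma encard_le_eRk_coneShade {I X : Set (ConePoint α m)} (hI : (coneShadow m M).Indep I)
    (hIX : I ⊆ X) : I.encard ≤ M.eRk (coneShade X) := by
  obtain ⟨⟨J, hJ, hIJ⟩, hinj⟩ := coneShadow_indep_iff.1 hI
  rw [← hinj.encard_image, hIJ, (Option.some_injective α).encard_image]
  refine hJ.encard_le_eRk_of_subset fun e he => ?_
  obtain ⟨x, hx, hxe⟩ : some e ∈ coneProj '' I := hIJ ▸ mem_image_of_mem _ he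
  exact mem_coneShade_iff.2 ⟨x, hIX hx, hxe⟩

/-- A set of points has at most one more than the rank of its shade as rank, because deleting one
point from an independent set leaves a set that is independent in the shadow; and its rank is
at most that of its part in the base plus the number of its other points. The rank of the free
cone is as large as these two bounds permit. -/
lemma eRk_coneMatroid {X : Set (ConePoint α m)} (hX : X ⊆ cone m M.E) :
    (coneMatroid m M hM).eRk X = min (M.eRk (coneShade X) + 1)
      (M.eRk (ConePoint.base ⁻¹' X) + (X \ range ConePoint.base).encard) := by
  refine le_antisymm ?_ ?_
  · refine eRk_le_iff.2 fun I hIX hI => le_min ?_ ?_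
    · obtain ⟨-, y, -, hy⟩ := coneMatroid_indep_iff.1 hI
      refine (encard_le_encard_sdiff_add_encard I {y}).trans ?_
      rw [encard_singleton]
      exact add_le_add (encard_le_eRk_coneShade hy (sdiff_subset.trans hIX)) le_rfl
    · rw [← encard_sdiff_add_encard_inter I (range ConePoint.base), add_comm]
      refine add_le_add ?_ (encard_le_encard (sdiff_subset_sdiff_left hIX))
      have h1 : I ∩ range ConePoint.base = ConePoint.base '' (ConePoint.base ⁻¹' I) := by
        rw [image_preimage_eq_inter_range]
      have h2 := hI.subset (inter_subset_left (t := range ConePoint.base))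
      rw [h1, coneMatroid_base] at h2
      rw [h1, base_injective.encard_image]
      exact h2.encard_le_eRk_of_subset (preimage_mono hIX)
  · obtain ⟨J, hJ⟩ := M.exists_isBasis' (ConePoint.base ⁻¹' X)
    have hsub : ConePoint.base ⁻¹' X ⊆ coneShade X := fun e he => Or.inl he
    obtain ⟨J', hJ', hJJ'⟩ := hJ.indep.subset_isBasis'_of_subset (hJ.subset.trans hsub)
    -- The elements of `J' \ J` lie outside the base part of `X`, so they lift to fibres in `X`.
    have hlift : ∀ e : α, ∃ x : ConePoint α m, coneProj x = some e ∧
        (e ∈ J → x = ConePoint.base e) ∧ (e ∈ J' → x ∈ X) := by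
      intro e
      by_cases heJ : e ∈ J
      · exact ⟨_, rfl, fun _ => rfl, fun _ => hJ.subset heJ⟩
      by_cases heJ' : e ∈ J'
      · obtain ⟨x, hx, hxe⟩ := mem_coneShade_iff.1 (hJ'.subset heJ')
        exact ⟨x, hxe, fun h => absurd h heJ, fun _ => hx⟩
      · exact ⟨ConePoint.base e, rfl, fun h => rfl, fun h => absurd h heJ'⟩
    choose g hg hgJ hgX using hlift
    have hginj : Function.Injective g := fun x y h => by
      have := (hg x).symm.trans ((congrArg coneProj h).trans (hg y))
      exact Option.some_injective _ this
    have hI : (coneShadow m M).Indep (g '' J') := by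
      refine coneShadow_indep_iff.2 ⟨⟨J', hJ'.indep, ?_⟩, ?_⟩
      · rw [image_image]
        exact image_congr fun x _ => hg x
      · rintro _ ⟨x, _, rfl⟩ _ ⟨y, _, rfl⟩ h
        rw [hg, hg] at h
        rw [Option.some_injective _ h]
    have hIX : g '' J' ⊆ X := by
      rintro _ ⟨x, hx, rfl⟩
      exact hgX x hx
    by_cases hF : ∃ y ∈ X \ range ConePoint.base, y ∉ g '' J'
    · obtain ⟨y, ⟨hyX, hyb⟩, hy⟩ := hF
      refine (min_le_left _ _).trans ?_
      have := (coneMatroid_indep_insert (hM := hM) hI (hX hyX) hyb).encard_le_eRk_of_subset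
        (insert_subset hyX hIX)
      rwa [encard_insert_of_notMem hy, hginj.encard_image, hJ'.encard_eq_eRk] at this
    · push Not at hF
      refine (min_le_right _ _).trans ?_
      have hQ : (coneMatroid m M hM).Indep (g '' J') :=
        coneMatroid_indep_iff.2 ⟨coneShadow_subset hI, ConePoint.tip, by simp,
          hI.subset sdiff_subset⟩
      refine le_trans ?_ (hQ.encard_le_eRk_of_subset hIX)
      rw [← hJ.encard_eq_eRk, ← (base_injective (m := m)).encard_image J,
        ← encard_union_eq]
      · refine encard_le_encard (union_subset ?_ hF)
        rintro _ ⟨e, he, rfl⟩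
        exact ⟨e, hJJ' he, hgJ e he⟩
      · rw [disjoint_left]
        rintro _ ⟨e, _, rfl⟩ h
        exact h.2 (mem_range_self e)

end ConeRank

/-! ### Orderings of the ground set and the G-invariant -/

section Orderings

variable {α β : Type*} {n : ℕ}

/-- Some bijection between two finite types with the same number of elements. -/
noncomputable def equivOfNatCardEq {R S : Type*} [Finite R] [Finite S]
    (h : Nat.card R = Nat.card S) : R ≃ S :=
  (Finite.equivFinOfCardEq h).trans (Finite.equivFin S).symm

lemma cast_natRk (M : Matroid α) [M.Finite] (X : Set α) : (M.natRk X : ℕ∞) = M.eRk X :=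
  ENat.natCast_toNat (eRk_ne_top_iff.2 (M.isRkFinite_set X))

lemma natRk_mono (M : Matroid α) [M.Finite] : Monotone M.natRk := fun X Y h => by
  rw [← Nat.cast_le (α := ℕ∞), cast_natRk, cast_natRk]
  exact M.eRk_mono h

/-- The rank of the set of elements that an ordering `π` puts at the positions in `S`. -/
noncomputable def orderRk (M : Matroid α) (π : Fin n ≃ M.E) (S : Set (Fin n)) : ℕ :=
  M.natRk ((fun j => (π j : α)) '' S)

lemma orderRk_mono (M : Matroid α) [M.Finite] (π : Fin n ≃ M.E) : Monotone (M.orderRk π) :=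
  fun _ _ h => M.natRk_mono (image_mono h)

lemma orderRk_empty (M : Matroid α) (π : Fin n ≃ M.E) : M.orderRk π ∅ = 0 := by
  simp [orderRk, natRk]

lemma orderRk_trans (M : Matroid α) (σ : Equiv.Perm (Fin n)) (π : Fin n ≃ M.E)
    (S : Set (Fin n)) : M.orderRk (σ.trans π) S = M.orderRk π (σ '' S) := by
  rw [orderRk, orderRk, image_image]
  rfl

/-- The rank sequence consists of the successive differences of the ranks of the initial segments,
so that two orderings have the same one if and only if these ranks agree. -/
lemma rankSequence_eq_iff {M : Matroid α} {N : Matroid β} [M.Finite] [N.Finite]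
    {π : Fin n ≃ M.E} {π' : Fin n ≃ N.E} : M.rankSequence π = N.rankSequence π' ↔
      ∀ k : ℕ, M.orderRk π {j | (j : ℕ) < k} = N.orderRk π' {j | (j : ℕ) < k} := by
  have hIio : ∀ i : Fin n, Iio i = {j : Fin n | (j : ℕ) < i} := fun i => rfl
  have hIic : ∀ i : Fin n, Iic i = {j : Fin n | (j : ℕ) < i + 1} := fun i => by
    ext j
    exact Nat.lt_succ_iff.symm
  constructor
  · intro h k
    have h' := List.ofFn_injective h
    induction k with
    | zero => simp [orderRk_empty]
    | succ k ih =>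
      by_cases hk : k < n
      · have h1 := congrFun h' ⟨k, hk⟩
        have h2 : M.orderRk π (Iio ⟨k, hk⟩) ≤ M.orderRk π (Iic ⟨k, hk⟩) :=
          M.orderRk_mono π Iio_subset_Iic_self
        have h3 : N.orderRk π' (Iio ⟨k, hk⟩) ≤ N.orderRk π' (Iic ⟨k, hk⟩) :=
          N.orderRk_mono π' Iio_subset_Iic_self
        change M.orderRk π (Iic ⟨k, hk⟩) - M.orderRk π (Iio ⟨k, hk⟩) =
          N.orderRk π' (Iic ⟨k, hk⟩) - N.orderRk π' (Iio ⟨k, hk⟩) at h1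
        rw [hIio, hIic] at h1 h2 h3
        dsimp only at h1 h2 h3
        omega
      · have : {j : Fin n | (j : ℕ) < k + 1} = {j : Fin n | (j : ℕ) < k} := by
          ext j
          have := j.2
          simp only [mem_ofPred_eq]
          omega
        rw [this, ih]
  · intro h
    refine congrArg List.ofFn (funext fun i => ?_)
    change M.orderRk π (Iic i) - M.orderRk π (Iio i) =
          N.orderRk π' (Iic i) - N.orderRk π' (Iio i)
    rw [hIio, hIic, h, h]

instance finite_orderings (M : Matroid α) [M.Finite] : Finite (Fin n ≃ M.E) :=
  have := M.ground_finite.to_subtype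
  inferInstance

lemma nonempty_orderings (M : Matroid α) [M.Finite] (hn : M.E.ncard = n) :
    Nonempty (Fin n ≃ M.E) := by
  have := M.ground_finite.to_subtype
  refine ⟨equivOfNatCardEq ?_⟩
  rw [Nat.card_coe_set_eq, hn, Nat.card_fin]

lemma gInvariant_apply (K : Type*) [Field K] (M : Matroid α) [M.Finite] (hn : M.E.ncard = n)
    (ρ : List ℕ) :
    M.gInvariant K ρ = (Nat.card {π : Fin n ≃ M.E // M.rankSequence π = ρ} : K) := by
  classical
  subst hn
  have := Fintype.ofFinite (Fin M.E.ncard ≃ M.E)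
  rw [gInvariant, finsum_eq_sum_of_fintype, Finsupp.finsetSum_apply, Nat.card_eq_fintype_card,
    Fintype.card_subtype]
  simp [Finsupp.single_apply]

lemma gInvariant_eq_iff (K : Type*) [Field K] [CharZero K] (M : Matroid α) (N : Matroid β)
    [M.Finite] [N.Finite] (hM : M.E.ncard = n) (hN : N.E.ncard = n) :
    M.gInvariant K = N.gInvariant K ↔
      ∀ ρ, Nat.card {π : Fin n ≃ M.E // M.rankSequence π = ρ} =
        Nat.card {π : Fin n ≃ N.E // N.rankSequence π = ρ} := by
  simp_rw [DFunLike.ext_iff, gInvariant_apply K M hM, gInvariant_apply K N hN, Nat.cast_inj]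

lemma ncard_ground_eq_of_gInvariant_eq {K : Type*} [Field K] [CharZero K] {M : Matroid α}
    {N : Matroid β} [M.Finite] [N.Finite] (h : M.gInvariant K = N.gInvariant K) :
    M.E.ncard = N.E.ncard := by
  obtain ⟨π⟩ := M.nonempty_orderings rfl
  have h1 := DFunLike.congr_fun h (M.rankSequence π)
  rw [gInvariant_apply K M rfl, gInvariant_apply K N rfl, Nat.cast_inj] at h1
  have : Nonempty {π' : Fin M.E.ncard ≃ M.E // M.rankSequence π' = M.rankSequence π} := ⟨⟨π, rfl⟩⟩
  have h2 : 0 < Nat.card {π' : Fin N.E.ncard ≃ N.E // N.rankSequence π' = M.rankSequence π} :=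
    h1 ▸ Nat.card_pos
  obtain ⟨⟨π', h3⟩⟩ := (Nat.card_pos_iff.1 h2).1
  simpa [rankSequence] using (congrArg List.length h3).symm

lemma card_fiber_le_eq_add {R γ : Type*} [Finite R] (u : R → γ) (v : R → ℕ) (c : γ) (s : ℕ) :
    Nat.card {p // u p = c ∧ s ≤ v p} =
      Nat.card {p // (u p, v p) = (c, s)} + Nat.card {p // u p = c ∧ s + 1 ≤ v p} := by
  classical
  have := Fintype.ofFinite R
  simp only [Nat.card_eq_fintype_card, Fintype.card_subtype]
  rw [← Finset.card_union_of_disjoint]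
  · congr 1
    ext p
    simp only [Finset.mem_filter, Finset.mem_univ, true_and, Finset.mem_union, Prod.mk.injEq]
    grind
  · rw [Finset.disjoint_filter]
    grind

/-- If the superlevel sets of `t` over each fibre of `b` have the same size as those of `t'` over the
fibre of `b'`, then some bijection matches `b` with `b'` and `t` with `t'`. -/
lemma exists_equiv_of_card_eq {P P' γ : Type*} [Finite P] [Finite P'] (b : P → γ) (b' : P' → γ)
    (t : P → ℕ) (t' : P' → ℕ)
    (h : ∀ c s, Nat.card {p // b p = c ∧ s ≤ t p} = Nat.card {p // b' p = c ∧ s ≤ t' p}) :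
    ∃ Φ : P ≃ P', ∀ p, b' (Φ p) = b p ∧ t' (Φ p) = t p := by
  have hcard : ∀ x : γ × ℕ, Nat.card {p // (b p, t p) = x} = Nat.card {p // (b' p, t' p) = x} := by
    rintro ⟨c, s⟩
    have h1 := card_fiber_le_eq_add b t c s
    have h2 := card_fiber_le_eq_add b' t' c s
    have h3 := h c s
    have h4 := h c (s + 1)
    omega
  refine ⟨Equiv.ofFiberEquiv (f := fun p => (b p, t p)) (g := fun p => (b' p, t' p))
    fun x => equivOfNatCardEq (hcard x), fun p => ?_⟩
  exact Prod.ext_iff.1 (Equiv.ofFiberEquiv_map (f := fun p => (b p, t p))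
    (g := fun p => (b' p, t' p)) (fun x => equivOfNatCardEq (hcard x)) p)

variable {M : Matroid α} {N : Matroid β} [M.Finite] [N.Finite]

/-- If the G-invariants agree, then for every chain of sets of positions some bijection between the
orderings preserves the ranks along the chain. (Permuting the positions turns the chain into a
chain of initial segments.) -/
lemma exists_equiv_orderRk_chain
    (h : ∀ ρ, Nat.card {π : Fin n ≃ M.E // M.rankSequence π = ρ} =
        Nat.card {π : Fin n ≃ N.E // N.rankSequence π = ρ})
    {C : ℕ → Set (Fin n)} (hC : Monotone C) :
    ∃ Φ : (Fin n ≃ M.E) ≃ (Fin n ≃ N.E), ∀ π j, N.orderRk (Φ π) (C j) = M.orderRk π (C j) := by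
  classical
  let Ψ : (Fin n ≃ M.E) ≃ (Fin n ≃ N.E) := Equiv.ofFiberEquiv (f := M.rankSequence)
    (g := N.rankSequence) fun ρ => equivOfNatCardEq (h ρ)
  have hΨ : ∀ π k, N.orderRk (Ψ π) {j | (j : ℕ) < k} = M.orderRk π {j | (j : ℕ) < k} := fun π =>
    rankSequence_eq_iff.1 (Equiv.ofFiberEquiv_map (f := M.rankSequence) (g := N.rankSequence)
      (fun ρ => equivOfNatCardEq (h ρ)) π)
  -- The level of a position is the first index at which it occurs in the chain.
  let f : Fin n → ℕ∞ := fun x => sInf {k : ℕ∞ | ∃ j : ℕ, x ∈ C j ∧ k = j}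
  have hf : ∀ x j, x ∈ C j ↔ f x ≤ j := by
    intro x j
    refine ⟨fun hx => sInf_le ⟨j, hx, rfl⟩, fun hx => ?_⟩
    have hne : {k : ℕ∞ | ∃ j : ℕ, x ∈ C j ∧ k = j}.Nonempty := by
      by_contra hemp
      rw [not_nonempty_iff_eq_empty] at hemp
      simp [f, hemp] at hx
    obtain ⟨i, hi, hfi⟩ := csInf_mem hne
    change f x = i at hfi
    rw [hfi, Nat.cast_le] at hx
    exact hC hx hi
  let σ := Tuple.sort f
  have hσ : ∀ j, ∃ k : ℕ, C j = σ '' {i | (i : ℕ) < k} := by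
    intro j
    have hlow : ∀ a b : Fin n, a ≤ b → σ b ∈ C j → σ a ∈ C j := fun a b hab hb =>
      (hf _ _).2 ((Tuple.monotone_sort f hab).trans ((hf _ _).1 hb))
    by_cases hall : ∀ a, σ a ∈ C j
    · refine ⟨n, ?_⟩
      ext x
      obtain ⟨a, rfl⟩ := σ.surjective x
      simpa using hall a
    · push Not at hall
      have hex : ∃ k : ℕ, ∃ hk : k < n, σ ⟨k, hk⟩ ∉ C j := by
        obtain ⟨a, ha⟩ := hall
        exact ⟨a, a.2, ha⟩
      refine ⟨Nat.find hex, ?_⟩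
      obtain ⟨h1, h2⟩ := Nat.find_spec hex
      ext x
      obtain ⟨a, rfl⟩ := σ.surjective x
      simp only [σ.injective.mem_set_image, mem_ofPred_eq]
      constructor
      · intro ha
        by_contra hlt
        exact h2 (hlow _ a (not_lt.1 hlt) ha)
      · intro ha
        have := Nat.find_min hex ha
        push Not at this
        exact this a.2
  refine ⟨(Equiv.equivCongr σ.symm (Equiv.refl _)).trans
    (Ψ.trans (Equiv.equivCongr σ (Equiv.refl _))), fun π j => ?_⟩
  obtain ⟨k, hk⟩ := hσ j
  have h1 : (Equiv.equivCongr σ.symm (Equiv.refl _)) π = σ.trans π := by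
    ext; simp
  have h2 : ∀ τ : Fin n ≃ N.E, (Equiv.equivCongr σ (Equiv.refl _)) τ = σ.symm.trans τ := by
    intro τ; ext; simp
  rw [Equiv.trans_apply, Equiv.trans_apply, h1, h2, hk, ← orderRk_trans, ← orderRk_trans,
    ← Equiv.trans_assoc, Equiv.self_trans_symm, Equiv.refl_trans, hΨ]

/-- The combinatorial core of the computation of the G-invariant of a free cone. For two chains
`B`, `D` and numbers `F` for which `r(D s) ≤ r(B s) + F s`, with equality exactly on an initial
segment of indices, the joint distribution of the numbers `min (r(D s) + 1) (r(B s) + F s)` over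
all orderings is determined by the G-invariant. Indeed these numbers depend only on the ranks
of the sets `D s` and on the first index `t` without equality; and if equality holds at `s`, then
all ranks in question can be read off from the chain `B 0 ⊆ ⋯ ⊆ B s ⊆ D s ⊆ D (s + 1) ⊆ ⋯`. -/
lemma exists_equiv_orderRk_min
    (h : ∀ ρ, Nat.card {π : Fin n ≃ M.E // M.rankSequence π = ρ} =
        Nat.card {π : Fin n ≃ N.E // N.rankSequence π = ρ})
    {B D : ℕ → Set (Fin n)} {F : ℕ → ℕ} (hB : Monotone B) (hD : Monotone D)
    (hBD : ∀ s, B s ⊆ D s)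
    (hM : ∀ (π : Fin n ≃ M.E) s, M.orderRk π (D s) ≤ M.orderRk π (B s) + F s)
    (hN : ∀ (π : Fin n ≃ N.E) s, N.orderRk π (D s) ≤ N.orderRk π (B s) + F s)
    (hM' : ∀ (π : Fin n ≃ M.E) s t, s ≤ t → M.orderRk π (D t) = M.orderRk π (B t) + F t →
      M.orderRk π (D s) = M.orderRk π (B s) + F s)
    (hN' : ∀ (π : Fin n ≃ N.E) s t, s ≤ t → N.orderRk π (D t) = N.orderRk π (B t) + F t →
      N.orderRk π (D s) = N.orderRk π (B s) + F s)
    {T : ℕ} (hTM : ∀ π : Fin n ≃ M.E, M.orderRk π (D T) ≠ M.orderRk π (B T) + F T)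
    (hTN : ∀ π : Fin n ≃ N.E, N.orderRk π (D T) ≠ N.orderRk π (B T) + F T) :
    ∃ Φ : (Fin n ≃ M.E) ≃ (Fin n ≃ N.E), ∀ π s,
      min (N.orderRk (Φ π) (D s) + 1) (N.orderRk (Φ π) (B s) + F s) =
        min (M.orderRk π (D s) + 1) (M.orderRk π (B s) + F s) := by
  classical
  let t : (Fin n ≃ M.E) → ℕ := fun π =>
    Nat.find (p := fun s => M.orderRk π (D s) ≠ M.orderRk π (B s) + F s) ⟨T, hTM π⟩
  let t' : (Fin n ≃ N.E) → ℕ := fun π =>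
    Nat.find (p := fun s => N.orderRk π (D s) ≠ N.orderRk π (B s) + F s) ⟨T, hTN π⟩
  have ht : ∀ π s, s + 1 ≤ t π ↔ M.orderRk π (D s) = M.orderRk π (B s) + F s := by
    intro π s
    refine ⟨fun hs => not_not.1 (Nat.find_min
      (p := fun s => M.orderRk π (D s) ≠ M.orderRk π (B s) + F s) ⟨T, hTM π⟩ hs), fun hs => ?_⟩
    by_contra hlt
    exact Nat.find_spec
      (p := fun s => M.orderRk π (D s) ≠ M.orderRk π (B s) + F s) ⟨T, hTM π⟩
      (hM' π _ s (Nat.lt_succ_iff.1 (not_le.1 hlt)) hs)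
  have ht' : ∀ π s, s + 1 ≤ t' π ↔ N.orderRk π (D s) = N.orderRk π (B s) + F s := by
    intro π s
    refine ⟨fun hs => not_not.1 (Nat.find_min
      (p := fun s => N.orderRk π (D s) ≠ N.orderRk π (B s) + F s) ⟨T, hTN π⟩ hs), fun hs => ?_⟩
    by_contra hlt
    exact Nat.find_spec
      (p := fun s => N.orderRk π (D s) ≠ N.orderRk π (B s) + F s) ⟨T, hTN π⟩
      (hN' π _ s (Nat.lt_succ_iff.1 (not_le.1 hlt)) hs)
  obtain ⟨Φ, hΦ⟩ := exists_equiv_of_card_eq (fun (π : Fin n ≃ M.E) s => M.orderRk π (D s))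
    (fun (π : Fin n ≃ N.E) s => N.orderRk π (D s)) t t' (by
      intro c s
      cases s with
      | zero =>
        obtain ⟨Φ, hΦ⟩ := exists_equiv_orderRk_chain h hD
        exact Nat.card_congr (Φ.subtypeEquiv fun π => by simp [hΦ])
      | succ s =>
        obtain ⟨Φ, hΦ⟩ := exists_equiv_orderRk_chain h
          (C := fun j => if j ≤ s then B j else D (j - 1)) (by
            intro i j hij
            dsimp only
            split_ifs with hi hj
            · exact hB hij
            · exact (hB (by omega : i ≤ j - 1)).trans (hBD _)
            · omega
            · exact hD (by omega))
        have hΦB : ∀ π, ∀ j ≤ s, N.orderRk (Φ π) (B j) = M.orderRk π (B j) := by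
          intro π j hj
          simpa [hj] using hΦ π j
        have hΦD : ∀ π, ∀ j, s ≤ j → N.orderRk (Φ π) (D j) = M.orderRk π (D j) := by
          intro π j hj
          simpa [show ¬ j + 1 ≤ s by omega] using hΦ π (j + 1)
        refine Nat.card_congr (Φ.subtypeEquiv fun π => ?_)
        have heq : s + 1 ≤ t π ↔ s + 1 ≤ t' (Φ π) := by
          rw [ht, ht', hΦD _ _ le_rfl, hΦB _ _ le_rfl]
        rw [← heq]
        refine and_congr_left fun hs => ?_
        have hfun : (fun j => M.orderRk π (D j)) = fun j => N.orderRk (Φ π) (D j) := by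
          funext j
          rcases le_total s j with hj | hj
          · exact (hΦD π j hj).symm
          · rw [(ht π j).1 (by omega), (ht' (Φ π) j).1 (by omega), hΦB π j hj]
        rw [hfun])
  refine ⟨Φ, fun π s => ?_⟩
  obtain ⟨h1, h2⟩ := hΦ π
  have h3 : N.orderRk (Φ π) (D s) = M.orderRk π (D s) := congrFun h1 s
  have h4 := ht π s
  have h5 := ht' (Φ π) s
  have h6 := hM π s
  have h7 := hN (Φ π) s
  rw [h2, h4] at h5
  omega

end Orderings

/-! ### The G-invariant of the free cone -/

section ConeInvariant

variable {α β : Type*} {m n : ℕ}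

lemma coneShade_mono {X Y : Set (ConePoint α m)} (h : X ⊆ Y) : coneShade X ⊆ coneShade Y :=
  fun _ he => he.imp (fun h' => h h') fun ⟨i, hi⟩ => ⟨i, h hi⟩

lemma ncard_coneShade_le {X : Set (ConePoint α m)} (hX : X.Finite) :
    (coneShade X).ncard ≤ X.ncard := by
  rw [← ncard_image_of_injective _ (Option.some_injective α)]
  refine (ncard_le_ncard ?_ (hX.image coneProj)).trans (ncard_image_le hX)
  rintro _ ⟨e, he, rfl⟩
  obtain ⟨x, hx, hxe⟩ := mem_coneShade_iff.1 he
  exact ⟨x, hx, hxe⟩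

lemma natRk_union_le_add_ncard (M : Matroid α) [M.Finite] (X : Set α) {Y : Set α}
    (hY : Y.Finite) : M.natRk (X ∪ Y) ≤ M.natRk X + Y.ncard := by
  rw [← Nat.cast_le (α := ℕ∞), Nat.cast_add, cast_natRk, cast_natRk, hY.cast_ncard_eq]
  exact M.eRk_union_le_eRk_add_encard X Y

lemma natRk_inter_add_natRk_union_le (M : Matroid α) [M.Finite] (X Y : Set α) :
    M.natRk (X ∩ Y) + M.natRk (X ∪ Y) ≤ M.natRk X + M.natRk Y := by
  rw [← Nat.cast_le (α := ℕ∞)]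
  push_cast
  simp only [cast_natRk]
  exact M.eRk_inter_add_eRk_union_le X Y

lemma coneShade_finite {X : Set (ConePoint α m)} (hX : X.Finite) : (coneShade X).Finite := by
  refine Finite.of_finite_image ((hX.image coneProj).subset ?_) (Option.some_injective α).injOn
  rintro _ ⟨e, he, rfl⟩
  obtain ⟨x, hx, hxe⟩ := mem_coneShade_iff.1 he
  exact ⟨x, hx, hxe⟩

variable (M : Matroid α) [M.Finite]

lemma natRk_coneMatroid {X : Set (ConePoint α m)} (hX : X ⊆ cone m M.E) :
    (coneMatroid m M M.ground_finite).natRk X = min (M.natRk (coneShade X) + 1)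
      (M.natRk (ConePoint.base ⁻¹' X) + (X \ range ConePoint.base).ncard) := by
  have hXf := (cone_finite M.ground_finite).subset hX
  have : (coneMatroid m M M.ground_finite).Finite := ⟨cone_finite M.ground_finite⟩
  rw [← Nat.cast_inj (R := ℕ∞)]
  rw [Nat.mono_cast.map_min, Nat.cast_add, Nat.cast_add, (hXf.subset sdiff_subset).cast_ncard_eq]
  simp only [cast_natRk]
  exact eRk_coneMatroid hX

/-- Passing from `Y` to a larger set `X` raises the rank of the shade by at most the increase of the
rank of the base part plus the number of new points outside the base. -/
lemma natRk_coneShade_add_le {X Y : Set (ConePoint α m)} (hX : X.Finite) (hYX : Y ⊆ X) :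
    M.natRk (coneShade X) + M.natRk (ConePoint.base ⁻¹' Y) + (Y \ range ConePoint.base).ncard ≤
      M.natRk (coneShade Y) + M.natRk (ConePoint.base ⁻¹' X) +
        (X \ range ConePoint.base).ncard := by
  have hF : (X \ range ConePoint.base).Finite := hX.subset sdiff_subset
  have hsub : Y \ range ConePoint.base ⊆ X \ range ConePoint.base := sdiff_subset_sdiff_left hYX
  set G := (X \ range ConePoint.base) \ (Y \ range ConePoint.base) with hG
  have hGf : G.Finite := hF.subset sdiff_subset
  have h1 : coneShade X ⊆ (coneShade Y ∪ ConePoint.base ⁻¹' X) ∪ coneShade G := by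
    rintro e (he | ⟨i, he⟩)
    · exact Or.inl (Or.inr he)
    · by_cases hY : ConePoint.fiber e i ∈ Y
      · exact Or.inl (Or.inl (Or.inr ⟨i, hY⟩))
      · exact Or.inr (Or.inr ⟨i, ⟨he, by simp⟩, fun h => hY h.1⟩)
  have h2 := (M.natRk_mono h1).trans (M.natRk_union_le_add_ncard _ (coneShade_finite hGf))
  have h3 := M.natRk_inter_add_natRk_union_le (coneShade Y) (ConePoint.base ⁻¹' X)
  have h4 : M.natRk (ConePoint.base ⁻¹' Y) ≤ M.natRk (coneShade Y ∩ ConePoint.base ⁻¹' X) :=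
    M.natRk_mono fun e he => ⟨Or.inl he, hYX he⟩
  have h5 := ncard_coneShade_le hGf
  have h6 := ncard_sdiff_add_ncard_of_subset hsub hF
  rw [← hG] at h6
  omega

lemma natRk_coneShade_le {X : Set (ConePoint α m)} (hX : X.Finite) :
    M.natRk (coneShade X) ≤
      M.natRk (ConePoint.base ⁻¹' X) + (X \ range ConePoint.base).ncard := by
  have := M.natRk_coneShade_add_le hX (empty_subset X)
  simpa [coneShade, natRk] using this

lemma natRk_coneShade_lt_of_tip_mem {X : Set (ConePoint α m)} (hX : X.Finite)
    (ht : ConePoint.tip ∈ X) : M.natRk (coneShade X) <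
      M.natRk (ConePoint.base ⁻¹' X) + (X \ range ConePoint.base).ncard := by
  have h1 := M.natRk_coneShade_le (hX.subset (sdiff_subset (t := {ConePoint.tip})))
  have h2 : coneShade (X \ {ConePoint.tip}) = coneShade X := by
    ext e
    simp [coneShade]
  have h3 : ConePoint.base ⁻¹' (X \ {ConePoint.tip}) = ConePoint.base ⁻¹' X := by
    ext e
    simp
  have h4 : ((X \ {ConePoint.tip}) \ range ConePoint.base).ncard <
      (X \ range ConePoint.base).ncard := by
    refine ncard_lt_ncard ?_ (hX.subset sdiff_subset)
    refine (ssubset_iff_of_subset (sdiff_subset_sdiff_left sdiff_subset)).2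
      ⟨ConePoint.tip, ⟨ht, by simp⟩, fun h => h.1.2 rfl⟩
  rw [h2, h3] at h1
  omega

/-- The map of cone points induced by a map of elements. -/
def ConePoint.map (f : α → β) : ConePoint α m → ConePoint β m
  | .base e => .base (f e)
  | .fiber e i => .fiber (f e) i
  | .tip => .tip

lemma ConePoint.map_injective {f : α → β} (hf : Function.Injective f) :
    Function.Injective (ConePoint.map f : ConePoint α m → ConePoint β m) := by
  intro x y h
  cases x <;> cases y <;> simp_all [ConePoint.map, hf.eq_iff]

lemma coneShade_image_map (f : α → β) (X : Set (ConePoint α m)) :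
    coneShade (ConePoint.map f '' X) = f '' coneShade X := by
  ext e
  constructor
  · rintro (⟨x, hx, h⟩ | ⟨i, x, hx, h⟩)
    · cases x with
      | base a => cases h; exact ⟨a, Or.inl hx, rfl⟩
      | fiber a j => cases h
      | tip => cases h
    · cases x with
      | base a => cases h
      | fiber a => cases h; exact ⟨a, Or.inr ⟨i, hx⟩, rfl⟩
      | tip => cases h
  · rintro ⟨a, h | ⟨i, h⟩, rfl⟩
    · exact Or.inl ⟨_, h, rfl⟩
    · exact Or.inr ⟨i, _, h, rfl⟩

lemma preimage_base_image_map (f : α → β) (X : Set (ConePoint α m)) :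
    ConePoint.base ⁻¹' (ConePoint.map f '' X) = f '' (ConePoint.base ⁻¹' X) := by
  ext e
  constructor
  · rintro ⟨x, hx, h⟩
    cases x with
    | base a => cases h; exact ⟨a, hx, rfl⟩
    | fiber a j => cases h
    | tip => cases h
  · rintro ⟨a, h, rfl⟩
    exact ⟨_, h, rfl⟩

lemma image_map_sdiff_range_base (f : α → β) (X : Set (ConePoint α m)) :
    (ConePoint.map f '' X) \ range ConePoint.base =
      ConePoint.map f '' (X \ range ConePoint.base) := by
  ext e
  constructor
  · rintro ⟨⟨x, hx, rfl⟩, h⟩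
    refine ⟨x, ⟨hx, ?_⟩, rfl⟩
    rintro ⟨a, rfl⟩
    exact h ⟨f a, rfl⟩
  · rintro ⟨x, ⟨hx, h⟩, rfl⟩
    refine ⟨⟨x, hx, rfl⟩, ?_⟩
    rintro ⟨a, ha⟩
    cases x with
    | base b => exact h ⟨b, rfl⟩
    | fiber b j => cases ha
    | tip => cases ha

variable {M}

/-- The labelling of the ground set of the free cone that is induced by an ordering of `M.E`. -/
noncomputable def coneLabel (m : ℕ) (π : Fin n ≃ M.E) :
    ConePoint (Fin n) m ≃ (coneMatroid m M M.ground_finite).E :=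
  Equiv.ofBijective
    (fun x => ⟨ConePoint.map (fun j => (π j : α)) x,
      by rw [coneMatroid_ground]; cases x <;> simp [ConePoint.map]⟩) (by
      constructor
      · intro x y h
        exact ConePoint.map_injective (Subtype.val_injective.comp π.injective)
          (congrArg Subtype.val h)
      · rintro ⟨x, hx⟩
        rw [coneMatroid_ground] at hx
        cases x with
        | base e =>
          exact ⟨.base (π.symm ⟨e, by simpa using hx⟩), by simp [ConePoint.map]⟩
        | fiber e i =>
          exact ⟨.fiber (π.symm ⟨e, by simpa using hx⟩) i, by simp [ConePoint.map]⟩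
        | tip => exact ⟨.tip, rfl⟩)

/-- For each ordering `π` of `M.E`, every ordering of the ground set of the free cone is induced by
`π` and exactly one ordering `w` of labels. -/
noncomputable def coneOrderings {T : ℕ} : (Fin T ≃ ConePoint (Fin n) m) × (Fin n ≃ M.E) ≃
    (Fin T ≃ (coneMatroid m M M.ground_finite).E) × (Fin n ≃ M.E) :=
  (Equiv.prodComm _ _).trans ((Equiv.prodShear (Equiv.refl _)
    fun π => Equiv.equivCongr (Equiv.refl _) (coneLabel m π)).trans (Equiv.prodComm _ _))

lemma coneOrderings_fst {T : ℕ} (p : (Fin T ≃ ConePoint (Fin n) m) × (Fin n ≃ M.E)) :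
    (coneOrderings p).1 = p.1.trans (coneLabel m p.2) := by
  ext
  simp [coneOrderings]

instance finite_conePoint [Finite α] : Finite (ConePoint α m) := by
  rw [← finite_univ_iff]
  refine (cone_finite (m := m) (finite_univ (α := α))).subset fun x _ => ?_
  cases x <;> simp

lemma map_sdiff_ncard {R : Matroid β} (π : Fin n ≃ R.E) (X : Set (ConePoint (Fin n) m)) :
    ((ConePoint.map (fun j => (π j : β)) '' X) \ range ConePoint.base).ncard =
      (X \ range ConePoint.base).ncard := by
  have h : Function.Injective (fun j => (π j : β)) := Subtype.val_injective.comp π.injective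
  rw [image_map_sdiff_range_base, ncard_image_of_injective _ (ConePoint.map_injective h)]

/-- The ranks in the free cone of the initial segments of an ordering of its ground set, when that
ordering comes from an ordering `π` of `M.E` and a fixed ordering `w` of labels. -/
lemma orderRk_coneMatroid {T : ℕ} (π : Fin n ≃ M.E) (w : Fin T ≃ ConePoint (Fin n) m)
    (S : Set (Fin T)) :
    (coneMatroid m M M.ground_finite).orderRk (w.trans (coneLabel m π)) S =
      min (M.orderRk π (coneShade (w '' S)) + 1)
        (M.orderRk π (ConePoint.base ⁻¹' (w '' S)) + ((w '' S) \ range ConePoint.base).ncard) := by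
  have h1 : (fun j => ((w.trans (coneLabel m π)) j : ConePoint α m)) '' S =
      ConePoint.map (fun j => (π j : α)) '' (w '' S) := by
    rw [image_image]
    rfl
  have h2 : ConePoint.map (fun j => (π j : α)) '' (w '' S) ⊆ cone m M.E := by
    rintro _ ⟨x, _, rfl⟩
    exact (coneLabel m π x).2
  rw [orderRk]
  rw [h1]
  rw [natRk_coneMatroid M h2, coneShade_image_map, preimage_base_image_map,
    map_sdiff_ncard]
  rfl

lemma orderRk_coneShade_le (π : Fin n ≃ M.E) (X : Set (ConePoint (Fin n) m)) :
    M.orderRk π (coneShade X) ≤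
      M.orderRk π (ConePoint.base ⁻¹' X) + (X \ range ConePoint.base).ncard := by
  have := M.natRk_coneShade_le (X.toFinite.image (ConePoint.map fun j => (π j : α)))
  rwa [coneShade_image_map, preimage_base_image_map, map_sdiff_ncard] at this

lemma orderRk_coneShade_eq_of_subset (π : Fin n ≃ M.E) {X Y : Set (ConePoint (Fin n) m)}
    (hYX : Y ⊆ X) (h : M.orderRk π (coneShade X) =
      M.orderRk π (ConePoint.base ⁻¹' X) + (X \ range ConePoint.base).ncard) :
    M.orderRk π (coneShade Y) =
      M.orderRk π (ConePoint.base ⁻¹' Y) + (Y \ range ConePoint.base).ncard := by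
  have h1 := M.natRk_coneShade_add_le (X.toFinite.image (ConePoint.map fun j => (π j : α)))
    (image_mono hYX)
  simp only [coneShade_image_map, preimage_base_image_map, map_sdiff_ncard] at h1
  have h2 := orderRk_coneShade_le π Y
  simp only [orderRk] at *
  omega

lemma orderRk_coneShade_lt_of_tip_mem (π : Fin n ≃ M.E) {X : Set (ConePoint (Fin n) m)}
    (hX : ConePoint.tip ∈ X) : M.orderRk π (coneShade X) <
      M.orderRk π (ConePoint.base ⁻¹' X) + (X \ range ConePoint.base).ncard := by
  have := M.natRk_coneShade_lt_of_tip_mem (X.toFinite.image (ConePoint.map fun j => (π j : α)))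
    ⟨_, hX, rfl⟩
  rwa [coneShade_image_map, preimage_base_image_map, map_sdiff_ncard] at this

variable {N : Matroid β} [N.Finite]

lemma exists_equiv_rankSequence_coneMatroid {T : ℕ}
    (h : ∀ ρ, Nat.card {π : Fin n ≃ M.E // M.rankSequence π = ρ} =
        Nat.card {π : Fin n ≃ N.E // N.rankSequence π = ρ})
    (w : Fin T ≃ ConePoint (Fin n) m) :
    ∃ Φ : (Fin n ≃ M.E) ≃ (Fin n ≃ N.E), ∀ π,
      (coneMatroid m N N.ground_finite).rankSequence (w.trans (coneLabel m (Φ π))) =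
        (coneMatroid m M M.ground_finite).rankSequence (w.trans (coneLabel m π)) := by
  have : (coneMatroid m M M.ground_finite).Finite := ⟨cone_finite M.ground_finite⟩
  have : (coneMatroid m N N.ground_finite).Finite := ⟨cone_finite N.ground_finite⟩
  let X : ℕ → Set (ConePoint (Fin n) m) := fun s => w '' {j | (j : ℕ) < s}
  have hX : Monotone X := fun s t hst => image_mono fun j hj => lt_of_lt_of_le hj hst
  have hXT : ConePoint.tip ∈ X T := ⟨w.symm .tip, (w.symm .tip).2, w.apply_symm_apply _⟩
  obtain ⟨Φ, hΦ⟩ := exists_equiv_orderRk_min h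
    (B := fun s => ConePoint.base ⁻¹' X s) (D := fun s => coneShade (X s))
    (F := fun s => (X s \ range ConePoint.base).ncard) (T := T)
    (fun s t hst => preimage_mono (hX hst)) (fun s t hst => coneShade_mono (hX hst))
    (fun s e he => Or.inl he)
    (fun π s => orderRk_coneShade_le π (X s)) (fun π s => orderRk_coneShade_le π (X s))
    (fun π s t hst => orderRk_coneShade_eq_of_subset π (hX hst))
    (fun π s t hst => orderRk_coneShade_eq_of_subset π (hX hst))
    (fun π => (orderRk_coneShade_lt_of_tip_mem π hXT).ne)
    (fun π => (orderRk_coneShade_lt_of_tip_mem π hXT).ne)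
  refine ⟨Φ, fun π => rankSequence_eq_iff.2 fun k => ?_⟩
  rw [orderRk_coneMatroid, orderRk_coneMatroid]
  exact hΦ π k

/-- The G-invariant of a free cone is determined by the G-invariant of the base. -/
theorem gInvariant_coneMatroid_eq {K : Type*} [Field K] [CharZero K]
    [(coneMatroid m M M.ground_finite).Finite] [(coneMatroid m N N.ground_finite).Finite]
    (hG : M.gInvariant K = N.gInvariant K) :
    (coneMatroid m M M.ground_finite).gInvariant K =
      (coneMatroid m N N.ground_finite).gInvariant K := by
  have hN := (ncard_ground_eq_of_gInvariant_eq hG).symm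
  obtain ⟨n, hM⟩ : ∃ n, M.E.ncard = n := ⟨_, rfl⟩
  rw [hM] at hN
  have h := (gInvariant_eq_iff K M N hM hN).1 hG
  obtain ⟨πM⟩ := M.nonempty_orderings hM
  obtain ⟨πN⟩ := N.nonempty_orderings hN
  have hTM : (coneMatroid m M M.ground_finite).E.ncard = Nat.card (ConePoint (Fin n) m) := by
    rw [← Nat.card_coe_set_eq, Nat.card_congr (coneLabel m πM)]
  have hTN : (coneMatroid m N N.ground_finite).E.ncard = Nat.card (ConePoint (Fin n) m) := by
    rw [← Nat.card_coe_set_eq, Nat.card_congr (coneLabel m πN)]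
  rw [gInvariant_eq_iff K _ _ hTM hTN]
  intro ρ
  set T := Nat.card (ConePoint (Fin n) m)
  choose Φ hΦ using fun w : Fin T ≃ ConePoint (Fin n) m =>
    exists_equiv_rankSequence_coneMatroid h w
  let eW : (Fin T ≃ ConePoint (Fin n) m) × (Fin n ≃ M.E) ≃
      (Fin T ≃ ConePoint (Fin n) m) × (Fin n ≃ N.E) := Equiv.prodShear (Equiv.refl _) Φ
  have hcard : Nat.card ({τ : Fin T ≃ (coneMatroid m M M.ground_finite).E //
        (coneMatroid m M M.ground_finite).rankSequence τ = ρ} × (Fin n ≃ M.E)) =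
      Nat.card ({τ : Fin T ≃ (coneMatroid m N N.ground_finite).E //
        (coneMatroid m N N.ground_finite).rankSequence τ = ρ} × (Fin n ≃ N.E)) := by
    refine Nat.card_congr ((Equiv.prodSubtypeFstEquivSubtypeProd (p := fun τ =>
      (coneMatroid m M M.ground_finite).rankSequence τ = ρ)).symm.trans
      ((Equiv.subtypeEquiv ((coneOrderings.symm.trans eW).trans coneOrderings) ?_).trans
        (Equiv.prodSubtypeFstEquivSubtypeProd (p := fun τ =>
          (coneMatroid m N N.ground_finite).rankSequence τ = ρ))))
    intro p
    obtain ⟨p, rfl⟩ := coneOrderings.surjective p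
    rw [Equiv.trans_apply, Equiv.trans_apply, Equiv.symm_apply_apply, coneOrderings_fst,
      coneOrderings_fst, ← hΦ p.1 p.2]
    rfl
  rw [Nat.card_prod, Nat.card_prod, Nat.card_congr (Equiv.equivCongr (Equiv.refl (Fin n))
    (πM.symm.trans πN))] at hcard
  exact Nat.eq_of_mul_eq_mul_right (Nat.card_pos_iff.2 ⟨⟨πN⟩, inferInstance⟩) hcard

end ConeInvariant

/-! ### Points of a loopless matroid -/

section Points

variable {α β : Type*}

/-- The points of a matroid: its flats of rank one. -/
def points (M : Matroid α) : Set (Set α) := {P | M.IsFlat P ∧ M.natRk P = 1}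

lemma natRk_closure (M : Matroid α) (X : Set α) : M.natRk (M.closure X) = M.natRk X := by
  rw [natRk, eRk_closure_eq, natRk]

lemma natRk_empty (M : Matroid α) : M.natRk ∅ = 0 := by
  simp [natRk]

lemma nonempty_of_natRk_pos {M : Matroid α} {X : Set α} (h : 0 < M.natRk X) : X.Nonempty := by
  rw [nonempty_iff_ne_empty]
  rintro rfl
  rw [natRk_empty] at h
  exact lt_irrefl _ h

lemma IsFlat.eq_of_subset_of_natRk_le {M : Matroid α} [M.Finite] {F G : Set α} (hF : M.IsFlat F)
    (hG : M.IsFlat G) (h : F ⊆ G) (hr : M.natRk G ≤ M.natRk F) : F = G := by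
  rw [← hF.closure, ← hG.closure]
  refine (M.isRkFinite_set F).closure_eq_closure_of_subset_of_eRk_ge_eRk h ?_
  rw [← cast_natRk, ← cast_natRk]
  exact_mod_cast hr

variable {M : Matroid α} {N : Matroid β}

lemma natRk_singleton [M.Loopless] {x : α} (hx : x ∈ M.E) : M.natRk {x} = 1 := by
  rw [natRk, eRk_singleton_eq hx]
  rfl

lemma isIsomorphic_of_natRk_le [M.Finite] [N.Finite] (e : M.E ≃ N.E)
    (h : ∀ X : Set M.E,
      N.natRk ((fun x : M.E => (e x : β)) '' X) ≤ M.natRk ((fun x : M.E => (x : α)) '' X))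
    (h' : ∀ Y : Set N.E,
      M.natRk ((fun y : N.E => (e.symm y : α)) '' Y) ≤ N.natRk ((fun y : N.E => (y : β)) '' Y)) :
    M.IsIsomorphic N := by
  refine ⟨e, fun I => ?_⟩
  have h1 := h' (e '' I)
  rw [image_image, image_image] at h1
  simp only [Equiv.symm_apply_apply] at h1
  have h2 := le_antisymm h1 (h I)
  have hinj : Function.Injective fun x : M.E => (e x : β) := Subtype.val_injective.comp e.injective
  rw [indep_iff_eRk_eq_encard, indep_iff_eRk_eq_encard, ← cast_natRk, ← cast_natRk, h2,
    Subtype.val_injective.encard_image, hinj.encard_image]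

lemma IsIsomorphic.symm (h : M.IsIsomorphic N) : N.IsIsomorphic M := by
  obtain ⟨e, he⟩ := h
  refine ⟨e.symm, fun I => ?_⟩
  rw [← image_image (g := fun x : M.E => (x : α)) (f := e.symm), he, image_image]
  simp

/-- The point that contains a given element. -/
def pointOf [M.Loopless] (x : M.E) : M.points :=
  ⟨M.closure {x.1}, isFlat_closure _, by rw [natRk_closure, natRk_singleton x.2]⟩

lemma mem_pointOf [M.Loopless] (x : M.E) : (x : α) ∈ (pointOf x : Set α) :=
  M.mem_closure_self x.1 x.2

variable [M.Finite] [N.Finite] [M.Loopless] [N.Loopless]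

lemma eq_empty_of_natRk_eq_zero {X : Set α} (hX : X ⊆ M.E) (h : M.natRk X = 0) : X = ∅ := by
  by_contra hne
  obtain ⟨x, hx⟩ := nonempty_iff_ne_empty.2 hne
  have := M.natRk_mono (singleton_subset_iff.2 hx)
  rw [natRk_singleton (hX hx)] at this
  omega

lemma pointOf_eq_iff {x : M.E} {P : M.points} : pointOf x = P ↔ (x : α) ∈ (P : Set α) := by
  refine ⟨fun h => h ▸ mem_pointOf x, fun h => Subtype.ext ?_⟩
  refine (isFlat_closure _).eq_of_subset_of_natRk_le P.2.1 ?_ ?_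
  · exact (M.closure_subset_closure (singleton_subset_iff.2 h)).trans P.2.1.closure.subset
  · rw [P.2.2, natRk_closure, natRk_singleton x.2]

/-- The elements whose point is `P` are the elements of `P`. -/
def fiberPointOfEquiv (P : M.points) : {x : M.E // pointOf x = P} ≃ (P : Set α) where
  toFun x := ⟨x.1, pointOf_eq_iff.1 x.2⟩
  invFun y := ⟨⟨y, P.2.1.subset_ground y.2⟩, pointOf_eq_iff.2 y.2⟩
  left_inv _ := rfl
  right_inv _ := rfl

instance finite_points (M : Matroid α) [M.Finite] : Finite M.points :=
  (M.ground_finite.finite_subsets.subset fun _ h => h.1.subset_ground).to_subtype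

lemma sum_ncard_points [Fintype M.points] :
    ∑ P : M.points, (P : Set α).ncard = M.E.ncard := by
  have := M.ground_finite.to_subtype
  rw [← Nat.card_coe_set_eq, ← Nat.card_congr (Equiv.sigmaFiberEquiv (pointOf (M := M))),
    Nat.card_sigma]
  exact Finset.sum_congr rfl fun P _ => by
    rw [Nat.card_congr (fiberPointOfEquiv P), Nat.card_coe_set_eq]

lemma exists_equiv_pointOf (σ : M.points ≃ N.points)
    (hσ : ∀ P, (σ P : Set β).ncard = (P : Set α).ncard) :
    ∃ e : M.E ≃ N.E, ∀ x, pointOf (e x) = σ (pointOf x) := by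
  have := M.ground_finite.to_subtype
  have := N.ground_finite.to_subtype
  have h : ∀ Q : N.points,
      Nat.card {x : M.E // σ (pointOf x) = Q} = Nat.card {y : N.E // pointOf y = Q} := by
    intro Q
    obtain ⟨P, rfl⟩ := σ.surjective Q
    simp_rw [σ.injective.eq_iff]
    rw [Nat.card_congr (fiberPointOfEquiv P), Nat.card_congr (fiberPointOfEquiv (σ P)),
      Nat.card_coe_set_eq, Nat.card_coe_set_eq, hσ]
  exact ⟨Equiv.ofFiberEquiv (f := fun x => σ (pointOf x)) (g := pointOf)
    fun Q => equivOfNatCardEq (h Q), fun x => Equiv.ofFiberEquiv_map _ x⟩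

/-- A size-preserving injection from the points of `N` to the points of `M` is onto, if the ground
sets have the same size. -/
lemma bijective_of_ncard_points (hE : M.E.ncard = N.E.ncard) {τ : N.points → M.points}
    (hτ : Function.Injective τ) (hs : ∀ P, (τ P : Set α).ncard = (P : Set β).ncard) :
    Function.Bijective τ := by
  classical
  refine ⟨hτ, fun P => ?_⟩
  by_contra hP
  push Not at hP
  have := Fintype.ofFinite M.points
  have := Fintype.ofFinite N.points
  have h1 : ∑ P' ∈ Finset.univ.image τ, (P' : Set α).ncard = N.E.ncard := by
    rw [Finset.sum_image hτ.injOn, ← sum_ncard_points]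
    exact Finset.sum_congr rfl fun P' _ => hs P'
  have h2 : ∑ P' ∈ Finset.univ.image τ, (P' : Set α).ncard < ∑ P' : M.points, (P' : Set α).ncard :=
    Finset.sum_lt_sum_of_subset (Finset.subset_univ _) (Finset.mem_univ P)
      (by simpa using hP)
      ((ncard_pos (M.ground_finite.subset P.2.1.subset_ground)).2
        (nonempty_of_natRk_pos (by rw [P.2.2]; exact one_pos))) (fun _ _ _ => Nat.zero_le _)
  rw [h1, sum_ncard_points] at h2
  omega

/-- In rank two, the rank of a set depends only on whether it is empty and on whether it is
contained in a point. -/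
lemma natRk_image_le_of_natRk_eq_two (e : M.E → N.E) (σ : M.points → N.points)
    (he : ∀ x, pointOf (e x) = σ (pointOf x)) (hN : N.natRk N.E ≤ 2) (X : Set M.E) :
    N.natRk ((fun x : M.E => (e x : β)) '' X) ≤ M.natRk ((fun x : M.E => (x : α)) '' X) := by
  have hXE : (fun x : M.E => (x : α)) '' X ⊆ M.E := by
    rintro _ ⟨x, _, rfl⟩
    exact x.2
  rcases Nat.lt_or_ge (M.natRk ((fun x : M.E => (x : α)) '' X)) 2 with hlt | hge
  · rcases X.eq_empty_or_nonempty with rfl | ⟨x, hx⟩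
    · simp [natRk_empty]
    have hne : ((fun x : M.E => (x : α)) '' X).Nonempty := ⟨x, x, hx, rfl⟩
    have h1 : M.natRk ((fun x : M.E => (x : α)) '' X) = 1 := by
      have : M.natRk ((fun x : M.E => (x : α)) '' X) ≠ 0 := fun h0 =>
        hne.ne_empty (eq_empty_of_natRk_eq_zero hXE h0)
      omega
    let P : M.points := ⟨M.closure ((fun x : M.E => (x : α)) '' X), isFlat_closure _, by
      rw [natRk_closure, h1]⟩
    have hP : ∀ y ∈ X, pointOf y = P := fun y hy =>
      pointOf_eq_iff.2 (M.subset_closure _ hXE (mem_image_of_mem _ hy))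
    rw [h1, ← (σ P).2.2]
    refine N.natRk_mono ?_
    rintro _ ⟨y, hy, rfl⟩
    rw [← pointOf_eq_iff, he, hP y hy]
  · refine le_trans ((N.natRk_mono ?_).trans hN) hge
    rintro _ ⟨x, _, rfl⟩
    exact (e x).2

end Points

/-! ### The lattice of cyclic flats of the free cone -/

section ConeLattice

variable {α β : Type*} {m : ℕ}

lemma cone_subset_cone {F G : Set α} : cone m F ⊆ cone m G ↔ F ⊆ G := by
  refine ⟨fun h e he => by simpa using h (base_mem_cone.2 he), fun h x hx => ?_⟩
  cases x with
  | base e => exact base_mem_cone.2 (h (base_mem_cone.1 hx))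
  | fiber e i => exact fiber_mem_cone.2 (h (fiber_mem_cone.1 hx))
  | tip => exact tip_mem_cone

lemma image_base_subset_cone {F G : Set α} :
    (ConePoint.base '' F : Set (ConePoint α m)) ⊆ cone m G ↔ F ⊆ G := by
  rw [image_subset_iff]
  exact ⟨fun h e he => base_mem_cone.1 (h he), fun h e he => base_mem_cone.2 (h he)⟩

lemma not_cone_subset_image_base {F Z : Set α} : ¬ cone m F ⊆ ConePoint.base '' Z := fun h => by
  obtain ⟨_, _, h⟩ := h (tip_mem_cone (S := F))
  cases h

lemma ncard_cone {S : Set α} (hS : S.Finite) : (cone m S).ncard = (m + 1) * S.ncard + 1 := by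
  have e : cone m S ≃ Option (S × Option (Fin m)) :=
    { toFun := fun x => match x with
        | ⟨.base e, h⟩ => some (⟨e, base_mem_cone.1 h⟩, none)
        | ⟨.fiber e i, h⟩ => some (⟨e, fiber_mem_cone.1 h⟩, some i)
        | ⟨.tip, _⟩ => none
      invFun := fun y => match y with
        | some (e, none) => ⟨.base e, base_mem_cone.2 e.2⟩
        | some (e, some i) => ⟨.fiber e i, fiber_mem_cone.2 e.2⟩
        | none => ⟨.tip, tip_mem_cone⟩
      left_inv := by
        rintro ⟨x, hx⟩
        cases x <;> rfl
      right_inv := by rintro (_ | ⟨_, _ | _⟩) <;> rfl }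
  have := hS.to_subtype
  rw [← Nat.card_coe_set_eq, Nat.card_congr e, Finite.card_option, Nat.card_prod,
    Finite.card_option, Nat.card_fin, Nat.card_coe_set_eq, mul_comm]

lemma exists_largest_cyclicFlat (M : Matroid α) :
    ∃ Z₀ ∈ M.cyclicFlats, ∀ Z ∈ M.cyclicFlats, Z ⊆ Z₀ := by
  have hE : ⋃₀ M.cyclicFlats ⊆ M.E := sUnion_subset fun Z hZ => hZ.1.subset_ground
  have hsub := M.subset_closure _ hE
  refine ⟨M.closure (⋃₀ M.cyclicFlats), mem_cyclicFlats_iff.2 ⟨isFlat_closure _, fun x hx => ?_⟩,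
    fun Z hZ => (subset_sUnion_of_mem hZ).trans hsub⟩
  by_cases hxC : x ∈ ⋃₀ M.cyclicFlats
  · obtain ⟨Z, hZ, hxZ⟩ := hxC
    exact M.closure_subset_closure (sdiff_subset_sdiff_left ((subset_sUnion_of_mem hZ).trans hsub))
      ((mem_cyclicFlats_iff.1 hZ).2 x hxZ)
  · exact M.closure_subset_closure (subset_sdiff_singleton hsub hxC) hx

/-- A point with at least two elements is a cyclic flat. -/
lemma mem_cyclicFlats_of_mem_points {M : Matroid α} [M.Finite] [M.Loopless] {P : Set α}
    (hP : P ∈ M.points) (h : 2 ≤ P.ncard) : P ∈ M.cyclicFlats := by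
  refine mem_cyclicFlats_iff.2 ⟨hP.1, fun x hx => ?_⟩
  obtain ⟨y, hy, hyx⟩ := exists_ne_of_one_lt_ncard h x
  have h1 : M.closure {y} = P := congrArg Subtype.val
    (pointOf_eq_iff.2 hy : pointOf ⟨y, hP.1.subset_ground hy⟩ = ⟨P, hP⟩)
  have h2 : {y} ⊆ P \ {x} := singleton_subset_iff.2 ⟨hy, hyx⟩
  exact M.closure_subset_closure h2 (h1.symm ▸ hx)

namespace IsFreeCone

variable {M : Matroid α} {Q : Matroid (ConePoint α m)}

/-- The cone of a nonempty flat, as a cyclic flat of the free cone. -/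
def coneFlat (hQ : IsFreeCone m M Q) (F : Set α) (hF : M.IsFlat F) (hne : F.Nonempty) :
    Q.cyclicFlats :=
  ⟨cone m F, by rw [hQ.cyclicFlats_eq]; exact Or.inr ⟨F, ⟨hF, hne⟩, rfl⟩⟩

/-- The copy of a cyclic flat in the base, as a cyclic flat of the free cone. -/
def baseFlat (hQ : IsFreeCone m M Q) (Z : Set α) (hZ : Z ∈ M.cyclicFlats) : Q.cyclicFlats :=
  ⟨ConePoint.base '' Z, by rw [hQ.cyclicFlats_eq]; exact Or.inl ⟨Z, hZ, rfl⟩⟩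

/-- The cone of a point, as a cyclic flat of the free cone. -/
def pointCone (hQ : IsFreeCone m M Q) (P : M.points) : Q.cyclicFlats :=
  hQ.coneFlat P P.2.1 (nonempty_of_natRk_pos (by rw [P.2.2]; exact one_pos))

variable (hQ : IsFreeCone m M Q)

lemma natRk_coneFlat [M.Finite] (F : Set α) (hF : M.IsFlat F) (hne : F.Nonempty) :
    Q.natRk (hQ.coneFlat F hF hne : Set _) = M.natRk F + 1 := by
  rw [natRk, coneFlat, hQ.eRk_cone F hF hne, ← cast_natRk]
  rfl

lemma natRk_baseFlat (Z : Set α) (hZ : Z ∈ M.cyclicFlats) :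
    Q.natRk (hQ.baseFlat Z hZ : Set _) = M.natRk Z := by
  rw [natRk, baseFlat, hQ.eRk_base Z hZ, natRk]

lemma natRk_pointCone [M.Finite] (P : M.points) : Q.natRk (hQ.pointCone P : Set _) = 2 := by
  rw [pointCone, natRk_coneFlat, P.2.2]

lemma ncard_pointCone [M.Finite] (P : M.points) :
    (hQ.pointCone P : Set (ConePoint α m)).ncard = (m + 1) * (P : Set α).ncard + 1 :=
  ncard_cone (M.ground_finite.subset P.2.1.subset_ground)

lemma ncard_baseFlat (Z : Set α) (hZ : Z ∈ M.cyclicFlats) :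
    (hQ.baseFlat Z hZ : Set (ConePoint α m)).ncard = Z.ncard :=
  ncard_image_of_injective _ base_injective

lemma eq_baseFlat_or_eq_coneFlat (x : Q.cyclicFlats) :
    (∃ Z hZ, x = hQ.baseFlat Z hZ) ∨ ∃ F hF hne, x = hQ.coneFlat F hF hne := by
  obtain ⟨x, hx⟩ := x
  have hx' := hx
  rw [hQ.cyclicFlats_eq] at hx'
  rcases hx' with ⟨Z, hZ, rfl⟩ | ⟨F, hF, rfl⟩
  · exact Or.inl ⟨Z, hZ, rfl⟩
  · exact Or.inr ⟨F, hF.1, hF.2, rfl⟩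

/-- A cyclic flat of rank two of the free cone is the cone of a point or lies in the base. -/
lemma eq_baseFlat_or_eq_pointCone [M.Finite] (x : Q.cyclicFlats) (hx : Q.natRk (x : Set _) = 2) :
    (∃ Z hZ, M.natRk Z = 2 ∧ x = hQ.baseFlat Z hZ) ∨ ∃ P, x = hQ.pointCone P := by
  rcases hQ.eq_baseFlat_or_eq_coneFlat x with ⟨Z, hZ, rfl⟩ | ⟨F, hF, hne, rfl⟩
  · exact Or.inl ⟨Z, hZ, by rwa [natRk_baseFlat] at hx, rfl⟩
  · rw [natRk_coneFlat] at hx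
    exact Or.inr ⟨⟨F, hF, by omega⟩, rfl⟩

lemma exists_eq_coneFlat_of_pointCone_le {P : M.points} {x : Q.cyclicFlats}
    (h : hQ.pointCone P ≤ x) : ∃ F hF hne, x = hQ.coneFlat F hF hne := by
  rcases hQ.eq_baseFlat_or_eq_coneFlat x with ⟨Z, hZ, rfl⟩ | h'
  · exact absurd h not_cone_subset_image_base
  · exact h'

lemma pointCone_le_coneFlat {P : M.points} {F : Set α} {hF : M.IsFlat F} {hne : F.Nonempty} :
    hQ.pointCone P ≤ hQ.coneFlat F hF hne ↔ (P : Set α) ⊆ F := cone_subset_cone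

lemma pointCone_ne_baseFlat (P : M.points) (Z : Set α) (hZ : Z ∈ M.cyclicFlats) :
    hQ.pointCone P ≠ hQ.baseFlat Z hZ := fun h =>
  not_cone_subset_image_base (congrArg Subtype.val h).subset

lemma pointCone_injective : Function.Injective hQ.pointCone := by
  intro P P' h
  have h1 := cone_subset_cone.1 (congrArg Subtype.val h).subset
  have h2 := cone_subset_cone.1 (congrArg Subtype.val h).superset
  exact Subtype.ext (subset_antisymm h1 h2)

end IsFreeCone

end ConeLattice

/-! ### Reconstructing a matroid from the configuration of its free cone -/

section Configuration

variable {α β : Type*} {m : ℕ} {M : Matroid α} {N : Matroid β}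
  {Q : Matroid (ConePoint α m)} {R : Matroid (ConePoint β m)}

/-- An isomorphism of the lattices of cyclic flats that preserves size and rank. -/
structure IsConfigIso (φ : Q.cyclicFlats ≃o R.cyclicFlats) : Prop where
  ncard_eq : ∀ x, (φ x : Set (ConePoint β m)).ncard = (x : Set (ConePoint α m)).ncard
  natRk_eq : ∀ x, R.natRk (φ x : Set (ConePoint β m)) = Q.natRk (x : Set (ConePoint α m))

lemma IsConfigIso.symm {φ : Q.cyclicFlats ≃o R.cyclicFlats} (h : IsConfigIso φ) :
    IsConfigIso φ.symm := by
  refine ⟨fun x => ?_, fun x => ?_⟩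
  · rw [← h.ncard_eq, φ.apply_symm_apply]
  · rw [← h.natRk_eq, φ.apply_symm_apply]

/-- An element of the lattice that lies above all elements that correspond to cones of points of `N`
lies above the cone of `M.E`. -/
lemma coneFlat_ground_le_of_forall_pointCone_le [N.Loopless]
    (hQ : IsFreeCone m M Q) (hR : IsFreeCone m N R)
    {φ : Q.cyclicFlats ≃o R.cyclicFlats} (P₀ : N.points) (x : Q.cyclicFlats)
    (h : ∀ P : N.points, φ.symm (hR.pointCone P) ≤ x) (hne : M.E.Nonempty) :
    hQ.coneFlat M.E M.ground_isFlat hne ≤ x := by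
  have h' : ∀ P : N.points, hR.pointCone P ≤ φ x := fun P => by
    rw [← φ.symm_apply_le]
    exact h P
  obtain ⟨H, hH, hHne, hxH⟩ := hR.exists_eq_coneFlat_of_pointCone_le (h' P₀)
  rw [← φ.le_iff_le, hxH]
  have hHE : N.E ⊆ H := fun y hy => by
    have := h' (pointOf ⟨y, hy⟩)
    rw [hxH, hR.pointCone_le_coneFlat] at this
    exact this (mem_pointOf ⟨y, hy⟩)
  have h1 : (φ (hQ.coneFlat M.E M.ground_isFlat hne) : Set (ConePoint β m)) ⊆ cone m N.E := by
    have := (φ (hQ.coneFlat M.E M.ground_isFlat hne)).2.1.subset_ground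
    rwa [hR.ground_eq] at this
  exact h1.trans (cone_subset_cone.2 hHE)

/-- If a cyclic flat `Z` of `M` of rank two corresponds to the cone of a point of `N`, then `Z`
contains each point of `M` whose cone corresponds to the cone of a point of `N`. The reason is that
the cones of two points lie in a cyclic flat of rank at most three. -/
lemma subset_of_pointCone_of_baseFlat [M.Finite] [N.Finite]
    (hQ : IsFreeCone m M Q) (hR : IsFreeCone m N R)
    {φ : Q.cyclicFlats ≃o R.cyclicFlats} (hφ : IsConfigIso φ) {Z : Set α} {hZ : Z ∈ M.cyclicFlats}
    (hZr : M.natRk Z = 2) {P' P₁ : N.points} (hZP : φ (hQ.baseFlat Z hZ) = hR.pointCone P')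
    {P : M.points} (hP : φ (hQ.pointCone P) = hR.pointCone P₁) : (P : Set α) ⊆ Z := by
  have hsub : (P' : Set β) ∪ P₁ ⊆ N.E := union_subset P'.2.1.subset_ground P₁.2.1.subset_ground
  have hcl := N.subset_closure _ hsub
  have hne : (P' : Set β).Nonempty := nonempty_of_natRk_pos (by rw [P'.2.2]; exact one_pos)
  set y := hR.coneFlat (N.closure (P' ∪ P₁)) (isFlat_closure _)
    (hne.mono (subset_union_left.trans hcl)) with hy
  have h1 : hR.pointCone P' ≤ y := hR.pointCone_le_coneFlat.2 (subset_union_left.trans hcl)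
  have h2 : hR.pointCone P₁ ≤ y := hR.pointCone_le_coneFlat.2 (subset_union_right.trans hcl)
  have h3 : N.natRk ((P' : Set β) ∪ P₁) ≤ 2 := by
    have := N.natRk_inter_add_natRk_union_le P' P₁
    rw [P'.2.2, P₁.2.2] at this
    omega
  rw [← hZP, ← φ.le_symm_apply] at h1
  rw [← hP, ← φ.le_symm_apply] at h2
  have h4 := hφ.symm.natRk_eq y
  obtain ⟨G, hG, hGne, hyG⟩ := hQ.exists_eq_coneFlat_of_pointCone_le h2
  rw [hyG, hQ.natRk_coneFlat, hy, hR.natRk_coneFlat, natRk_closure] at h4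
  rw [hyG] at h1 h2
  rw [hZ.1.eq_of_subset_of_natRk_le hG (image_base_subset_cone.1 h1) (by omega)]
  exact hQ.pointCone_le_coneFlat.1 h2

/-- In rank two and without coloops, the cyclic flats of rank two of the free cone are the cones of
the points and the base. -/
lemma exists_equiv_option_points [M.Finite] (hQ : IsFreeCone m M Q) (hE : M.E ∈ M.cyclicFlats)
    (hr : M.natRk M.E = 2) :
    ∃ f : Option M.points ≃ {x : Q.cyclicFlats // Q.natRk (x : Set (ConePoint α m)) = 2},
      (f none).1 = hQ.baseFlat M.E hE ∧ ∀ P, (f (some P)).1 = hQ.pointCone P := by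
  let g : Option M.points → {x : Q.cyclicFlats // Q.natRk (x : Set (ConePoint α m)) = 2} :=
    fun P => P.elim ⟨hQ.baseFlat M.E hE, by rw [hQ.natRk_baseFlat, hr]⟩
      fun P => ⟨hQ.pointCone P, hQ.natRk_pointCone P⟩
  refine ⟨Equiv.ofBijective g ⟨?_, ?_⟩, rfl, fun _ => rfl⟩
  · rintro (_ | P) (_ | P') h
    · rfl
    · exact absurd (congrArg Subtype.val h).symm (hQ.pointCone_ne_baseFlat _ _ hE)
    · exact absurd (congrArg Subtype.val h) (hQ.pointCone_ne_baseFlat _ _ hE)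
    · exact congrArg some (hQ.pointCone_injective (congrArg Subtype.val h))
  · rintro ⟨x, hx⟩
    rcases hQ.eq_baseFlat_or_eq_pointCone x hx with ⟨Z, hZ, hZr, rfl⟩ | ⟨P, rfl⟩
    · have : Z = M.E := hZ.1.eq_of_subset_of_natRk_le M.ground_isFlat hZ.1.subset_ground
        (by omega)
      subst this
      exact ⟨none, rfl⟩
    · exact ⟨some P, rfl⟩

variable [M.Finite] [N.Finite] [M.Loopless] [N.Loopless]

/-- If `φ` sends cones of points to cones of points, then the rank function of `M` can be read
off from the lattice, because the cone of the closure of `X` is the least cyclic flat that contains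
the cones of the points of the elements of `X`. -/
lemma natRk_image_le_of_pointCone (hQ : IsFreeCone m M Q) (hR : IsFreeCone m N R)
    {φ : Q.cyclicFlats ≃o R.cyclicFlats} (hφ : IsConfigIso φ) (e : M.E → N.E)
    (σ : M.points → N.points) (he : ∀ x, pointOf (e x) = σ (pointOf x))
    (hσ : ∀ P, φ (hQ.pointCone P) = hR.pointCone (σ P)) (X : Set M.E) :
    N.natRk ((fun x : M.E => (e x : β)) '' X) ≤ M.natRk ((fun x : M.E => (x : α)) '' X) := by
  rcases X.eq_empty_or_nonempty with rfl | ⟨x₀, hx₀⟩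
  · simp [natRk_empty]
  set Y := (fun x : M.E => (x : α)) '' X with hY
  have hYE : Y ⊆ M.E := by
    rintro _ ⟨x, _, rfl⟩
    exact x.2
  have hne : (M.closure Y).Nonempty := ⟨x₀, M.subset_closure Y hYE ⟨x₀, hx₀, rfl⟩⟩
  set y := hQ.coneFlat (M.closure Y) (isFlat_closure _) hne with hy
  have hle : ∀ x ∈ X, hR.pointCone (pointOf (e x)) ≤ φ y := by
    intro x hx
    rw [he, ← hσ, φ.le_iff_le]
    refine hQ.pointCone_le_coneFlat.2 (M.closure_subset_closure ?_)
    exact singleton_subset_iff.2 ⟨x, hx, rfl⟩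
  obtain ⟨H, hH, hHne, hyH⟩ := hR.exists_eq_coneFlat_of_pointCone_le (hle x₀ hx₀)
  have h1 := hφ.natRk_eq y
  rw [hyH, hR.natRk_coneFlat, hy, hQ.natRk_coneFlat, natRk_closure] at h1
  have h2 : N.natRk ((fun x : M.E => (e x : β)) '' X) ≤ N.natRk H := by
    refine N.natRk_mono ?_
    rintro _ ⟨x, hx, rfl⟩
    have := hle x hx
    rw [hyH, hR.pointCone_le_coneFlat] at this
    exact this (mem_pointOf _)
  omega

/-- If every cone of a point of `N` corresponds to the cone of a point of `M`, then `M` and `N` are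
isomorphic. -/
lemma isIsomorphic_of_forall_pointCone (hQ : IsFreeCone m M Q) (hR : IsFreeCone m N R)
    (hE : M.E.ncard = N.E.ncard) {φ : Q.cyclicFlats ≃o R.cyclicFlats} (hφ : IsConfigIso φ)
    (h : ∀ P' : N.points, ∃ P : M.points, φ (hQ.pointCone P) = hR.pointCone P') :
    M.IsIsomorphic N := by
  choose τ hτ using h
  have hinj : Function.Injective τ := fun P P' hP =>
    hR.pointCone_injective (by rw [← hτ, ← hτ, hP])
  have hs : ∀ P, (τ P : Set α).ncard = (P : Set β).ncard := by
    intro P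
    have h1 := hφ.ncard_eq (hQ.pointCone (τ P))
    rw [hτ, hR.ncard_pointCone, hQ.ncard_pointCone] at h1
    exact (Nat.eq_of_mul_eq_mul_left m.succ_pos (Nat.succ_injective h1)).symm
  let σ := (Equiv.ofBijective τ (bijective_of_ncard_points hE hinj hs)).symm
  have hτσ : ∀ P, τ (σ P) = P := fun P => Equiv.ofBijective_apply_symm_apply τ _ P
  obtain ⟨e, he⟩ := exists_equiv_pointOf σ fun P => by rw [← hs, hτσ]
  refine isIsomorphic_of_natRk_le e
    (natRk_image_le_of_pointCone hQ hR hφ e σ he fun P => by rw [← hτ, hτσ])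
    (natRk_image_le_of_pointCone hR hQ hφ.symm e.symm τ (fun y => ?_) fun P => ?_)
  · obtain ⟨x, rfl⟩ := e.surjective y
    rw [e.symm_apply_apply, he, hτσ]
  · rw [← hτ, φ.symm_apply_apply]

/-- Either the cones of points of `N` correspond to cones of points of `M`, or `M` has rank two and
no coloops. -/
lemma forall_pointCone_or_natRk_ground_eq_two (hm : 1 ≤ m) (hQ : IsFreeCone m M Q)
    (hR : IsFreeCone m N R) (hE : M.E.ncard = N.E.ncard) {φ : Q.cyclicFlats ≃o R.cyclicFlats}
    (hφ : IsConfigIso φ) :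
    (∀ P' : N.points, ∃ P : M.points, φ (hQ.pointCone P) = hR.pointCone P') ∨
      (M.E ∈ M.cyclicFlats ∧ M.natRk M.E = 2) := by
  have hdich : ∀ P' : N.points, (∃ P : M.points, φ (hQ.pointCone P) = hR.pointCone P') ∨
      ∃ Z, ∃ hZ : Z ∈ M.cyclicFlats, M.natRk Z = 2 ∧ φ (hQ.baseFlat Z hZ) = hR.pointCone P' := by
    intro P'
    have h1 : Q.natRk (φ.symm (hR.pointCone P') : Set (ConePoint α m)) = 2 := by
      rw [hφ.symm.natRk_eq, hR.natRk_pointCone]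
    rcases hQ.eq_baseFlat_or_eq_pointCone _ h1 with ⟨Z, hZ, hZr, h⟩ | ⟨P, h⟩
    · exact Or.inr ⟨Z, hZ, hZr, by rw [← h, φ.apply_symm_apply]⟩
    · exact Or.inl ⟨P, by rw [← h, φ.apply_symm_apply]⟩
  rw [or_iff_not_imp_left]
  intro hnot
  push Not at hnot
  obtain ⟨P', hP'⟩ := hnot
  obtain ⟨Z, hZ, hZr, hZP⟩ := (hdich P').resolve_left fun ⟨P, hP⟩ => hP' P hP
  have hEne : M.E.Nonempty := (nonempty_of_natRk_pos (by omega : 0 < M.natRk Z)).mono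
    hZ.1.subset_ground
  obtain ⟨Z₀, hZ₀, hmax⟩ := M.exists_largest_cyclicFlat
  -- Not all elements in question lie in the base, because the tip is in their join.
  obtain ⟨P, P₁, hP⟩ : ∃ P P₁, φ (hQ.pointCone P) = hR.pointCone P₁ := by
    by_contra hcon
    push Not at hcon
    refine not_cone_subset_image_base (F := M.E) (Z := Z₀) (m := m)
      (coneFlat_ground_le_of_forall_pointCone_le hQ hR (φ := φ) P' (hQ.baseFlat Z₀ hZ₀)
        (fun P₁ => ?_) hEne)
    obtain ⟨Z', hZ', -, hZP'⟩ := (hdich P₁).resolve_left fun ⟨P, hP⟩ => hcon P P₁ hP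
    rw [φ.symm_apply_le, ← hZP', φ.le_iff_le]
    exact image_mono (hmax Z' hZ')
  by_cases hex : ∃ P₂ P₃, φ (hQ.pointCone P₂) = hR.pointCone P₃ ∧ P₂ ≠ P
  · -- Two points span every line that corresponds to a cone, so that there is only one such line.
    obtain ⟨P₂, P₃, hP₂, hne⟩ := hex
    have hline : ∀ Z', ∀ hZ' : Z' ∈ M.cyclicFlats, M.natRk Z' = 2 → ∀ P₄,
        φ (hQ.baseFlat Z' hZ') = hR.pointCone P₄ → M.closure (P ∪ P₂) = Z' := by
      intro Z' hZ' hr P₄ hP₄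
      have h1 := subset_of_pointCone_of_baseFlat hQ hR hφ hr hP₄ hP
      have h2 := subset_of_pointCone_of_baseFlat hQ hR hφ hr hP₄ hP₂
      have hsub : (P : Set α) ∪ P₂ ⊆ M.E := union_subset P.2.1.subset_ground P₂.2.1.subset_ground
      refine (isFlat_closure _).eq_of_subset_of_natRk_le hZ'.1
        ((M.closure_subset_closure (union_subset h1 h2)).trans hZ'.1.closure.subset) ?_
      rw [hr]
      by_contra hlt
      rw [not_le] at hlt
      have hcl := M.subset_closure _ hsub
      have h3 := P.2.1.eq_of_subset_of_natRk_le (isFlat_closure _)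
        (subset_union_left.trans hcl) (by rw [P.2.2]; omega)
      have h4 := P₂.2.1.eq_of_subset_of_natRk_le (isFlat_closure _)
        (subset_union_right.trans hcl) (by rw [P₂.2.2]; omega)
      exact hne (Subtype.ext (h4.trans h3.symm))
    have hZne : Z.Nonempty := nonempty_of_natRk_pos (hZr ▸ two_pos)
    have htop := coneFlat_ground_le_of_forall_pointCone_le hQ hR (φ := φ) P'
      (hQ.coneFlat Z hZ.1 hZne) (fun P₄ => by
        rcases hdich P₄ with ⟨P₅, hP₅⟩ | ⟨Z', hZ', hr, hZP'⟩
        · rw [φ.symm_apply_le, ← hP₅, φ.le_iff_le, hQ.pointCone_le_coneFlat]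
          exact subset_of_pointCone_of_baseFlat hQ hR hφ hZr hZP hP₅
        · rw [φ.symm_apply_le, ← hZP', φ.le_iff_le]
          have : Z' = Z := (hline Z' hZ' hr P₄ hZP').symm.trans (hline Z hZ hZr P' hZP)
          exact image_base_subset_cone.2 this.subset) hEne
    have hZE : Z = M.E := subset_antisymm hZ.1.subset_ground (cone_subset_cone.1 htop)
    exact ⟨hZE ▸ hZ, hZE ▸ hZr⟩
  · -- Otherwise all points of `N` but `P₁` lie in a flat `H` whose cone has only `|Z₀|` elements;
    -- but `|Z₀| ≤ |N.E|`, while `H` misses no more than `P₁`.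
    exfalso
    push Not at hex
    have hother : ∀ P₂ : N.points, P₂ ≠ P₁ → hR.pointCone P₂ ≤ φ (hQ.baseFlat Z₀ hZ₀) := by
      intro P₂ hP₂
      rcases hdich P₂ with ⟨P₃, hP₃⟩ | ⟨Z', hZ', hr, hZP'⟩
      · rw [hex P₃ P₂ hP₃, hP] at hP₃
        exact absurd (hR.pointCone_injective hP₃).symm hP₂
      · rw [← hZP', φ.le_iff_le]
        exact image_mono (hmax Z' hZ')
    have hP'P₁ : P' ≠ P₁ := by
      rintro rfl
      exact hP' P hP
    obtain ⟨H, hH, hHne, hZH⟩ := hR.exists_eq_coneFlat_of_pointCone_le (hother P' hP'P₁)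
    have hHP : N.E ⊆ H ∪ P₁ := by
      intro y hy
      by_cases hyP : pointOf ⟨y, hy⟩ = P₁
      · exact Or.inr (pointOf_eq_iff.1 hyP)
      · have := hother _ hyP
        rw [hZH, hR.pointCone_le_coneFlat] at this
        exact Or.inl (this (mem_pointOf ⟨y, hy⟩))
    have hHf := N.ground_finite.subset hH.subset_ground
    have hPf := N.ground_finite.subset P₁.2.1.subset_ground
    have h1 := hφ.ncard_eq (hQ.baseFlat Z₀ hZ₀)
    rw [hZH, hQ.ncard_baseFlat] at h1
    have h2 : (m + 1) * H.ncard + 1 = Z₀.ncard := (ncard_cone hHf).symm.trans h1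
    have h3 : Z₀.ncard ≤ M.E.ncard := ncard_le_ncard hZ₀.1.subset_ground M.ground_finite
    have h4 : N.E.ncard ≤ H.ncard + (P₁ : Set β).ncard :=
      (ncard_le_ncard hHP (hHf.union hPf)).trans (ncard_union_le _ _)
    have h5 : 0 < H.ncard := (ncard_pos hHf).2 hHne
    have h6 : 2 * H.ncard ≤ (m + 1) * H.ncard := Nat.mul_le_mul_right _ (by omega)
    have h7 : 2 ≤ (P₁ : Set β).ncard := by omega
    -- The point `P₁` is a cyclic flat of rank one, so it corresponds to a subset of the base.
    set y := hR.baseFlat P₁ (mem_cyclicFlats_of_mem_points P₁.2 h7) with hy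
    have h8 := hφ.symm.natRk_eq y
    rw [hy, hR.natRk_baseFlat, P₁.2.2, ← hy] at h8
    rcases hQ.eq_baseFlat_or_eq_coneFlat (φ.symm y) with ⟨Z', hZ', h9⟩ | ⟨F, hF, hFne, h9⟩
    · have h10 : y ≤ φ (hQ.baseFlat Z₀ hZ₀) := by
        rw [← φ.symm_apply_le, h9]
        exact image_mono (hmax Z' hZ')
      rw [hZH] at h10
      have h11 : (P₁ : Set β) ⊆ H := image_base_subset_cone.1 h10
      have h12 := ncard_le_ncard (hHP.trans (union_subset subset_rfl h11)) hHf
      omega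
    · rw [h9, hQ.natRk_coneFlat] at h8
      have h10 := eq_empty_of_natRk_eq_zero hF.subset_ground (by omega)
      exact hFne.ne_empty h10

/-- In rank two, a lattice isomorphism may exchange the base with the cone of a point, but the sizes
of the points are still determined, and these determine the matroid. -/
lemma isIsomorphic_of_natRk_ground_eq_two (hQ : IsFreeCone m M Q) (hR : IsFreeCone m N R)
    (hE : M.E.ncard = N.E.ncard) {φ : Q.cyclicFlats ≃o R.cyclicFlats} (hφ : IsConfigIso φ)
    (hM : M.E ∈ M.cyclicFlats) (hMr : M.natRk M.E = 2)
    (hN : N.E ∈ N.cyclicFlats) (hNr : N.natRk N.E = 2) : M.IsIsomorphic N := by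
  obtain ⟨f, hf0, hf⟩ := exists_equiv_option_points hQ hM hMr
  obtain ⟨g, hg0, hg⟩ := exists_equiv_option_points hR hN hNr
  let ψ : Option M.points ≃ Option N.points := (f.trans (φ.toEquiv.subtypeEquiv fun x => by
    rw [← hφ.natRk_eq]; rfl)).trans g.symm
  have hψ : ∀ P, (g (ψ P)).1 = φ (f P).1 := fun P => by simp [ψ]
  have hsome : ∀ P P', ψ (some P) = some P' → (P' : Set β).ncard = (P : Set α).ncard := by
    intro P P' h
    have h1 := hψ (some P)
    rw [h, hg, hf] at h1
    have h2 := hφ.ncard_eq (hQ.pointCone P)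
    rw [← h1, hR.ncard_pointCone, hQ.ncard_pointCone] at h2
    exact Nat.eq_of_mul_eq_mul_left m.succ_pos (Nat.succ_injective h2)
  have hσ : ∀ P, (Equiv.removeNone ψ P : Set β).ncard = (P : Set α).ncard := by
    intro P
    cases h : ψ (some P) with
    | some P' => exact hsome P _ (Equiv.removeNone_some ψ ⟨P', h⟩).symm
    | none =>
      have h0 := Equiv.removeNone_none ψ h
      have h1 := hψ (some P)
      rw [h, hg0, hf] at h1
      have h2 := hψ none
      rw [← h0, hg, hf0] at h2
      have h3 := hφ.ncard_eq (hQ.pointCone P)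
      rw [← h1, hR.ncard_baseFlat, hQ.ncard_pointCone] at h3
      have h4 := hφ.ncard_eq (hQ.baseFlat M.E hM)
      rw [← h2, hQ.ncard_baseFlat, hR.ncard_pointCone] at h4
      exact Nat.eq_of_mul_eq_mul_left m.succ_pos (Nat.succ_injective (h4.trans (hE.trans h3)))
  obtain ⟨e, he⟩ := exists_equiv_pointOf _ hσ
  refine isIsomorphic_of_natRk_le e
    (natRk_image_le_of_natRk_eq_two e _ he hNr.le)
    (natRk_image_le_of_natRk_eq_two e.symm (Equiv.removeNone ψ).symm (fun y => ?_) hMr.le)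
  obtain ⟨x, rfl⟩ := e.surjective y
  rw [e.symm_apply_apply, he, Equiv.symm_apply_apply]

/-- A loopless matroid is determined up to isomorphism by the configuration of its free cone. -/
theorem isIsomorphic_of_sameConfiguration (hm : 1 ≤ m) (hQ : IsFreeCone m M Q)
    (hR : IsFreeCone m N R) (hE : M.E.ncard = N.E.ncard) (h : Q.SameConfiguration R) :
    M.IsIsomorphic N := by
  obtain ⟨φ, hφ⟩ := h
  have hφ' : IsConfigIso φ := ⟨fun x => by rw [ncard, (hφ x).1, ncard],
    fun x => by rw [natRk, (hφ x).2, natRk]⟩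
  rcases forall_pointCone_or_natRk_ground_eq_two hm hQ hR hE hφ' with h | ⟨hM, hMr⟩
  · exact isIsomorphic_of_forall_pointCone hQ hR hE hφ' h
  rcases forall_pointCone_or_natRk_ground_eq_two hm hR hQ hE.symm hφ'.symm with h | ⟨hN, hNr⟩
  · exact (isIsomorphic_of_forall_pointCone hR hQ hE.symm hφ'.symm h).symm
  exact isIsomorphic_of_natRk_ground_eq_two hQ hR hE hφ' hM hMr hN hNr

end Configuration
end Matroid

theorem theorem3p2 {K : Type*} [Field K] [CharZero K] {α β : Type*}
    (M : Matroid α) [M.Finite] [M.Loopless] (N : Matroid β) [N.Finite] [N.Loopless]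
    (hMN : ¬ M.IsIsomorphic N) (hG : M.gInvariant K = N.gInvariant K)
    (m : ℕ) (hm : 1 ≤ m) :
    (M.freeCone m hm).gInvariant K = (N.freeCone m hm).gInvariant K ∧
      ¬ (M.freeCone m hm).SameConfiguration (N.freeCone m hm) := by
  refine ⟨?_, fun h => hMN (Matroid.isIsomorphic_of_sameConfiguration hm
    (Matroid.isFreeCone_freeCone m hm M) (Matroid.isFreeCone_freeCone m hm N)
    (Matroid.ncard_ground_eq_of_gInvariant_eq hG) h)⟩
  have : (Matroid.coneMatroid m M M.ground_finite).Finite := ⟨Matroid.cone_finite M.ground_finite⟩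
  have : (Matroid.coneMatroid m N N.ground_finite).Finite := ⟨Matroid.cone_finite N.ground_finite⟩
  have h := Matroid.gInvariant_coneMatroid_eq (m := m) hG
  convert h using 1
  · congr 1
    exact Matroid.freeCone_eq_coneMatroid m hm M
  · congr 1
    exact Matroid.freeCone_eq_coneMatroid m hm N
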